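/- **Setting.** Let $d\ge 1$ and let $\mu(z)=(1+e^{-z})^{-1}$ be the sigmoid, $L=1/4$. Let $\Theta\subset\mathbb R^d$ be compact, $\theta_*\in\Theta$ and $S=\max_{\theta\in\Theta}\|\theta\|_2$. At each round $t\ge 1$ an agent is presented a (possibly random, possibly infinite) set $\mathcal X_t$ of arms, all of Euclidean norm at most $1$, plays $x_t\in\mathcal X_t$ and receives a binary reward $r_{t+1}\in\{0,1\}$ with $$\mathbb P(r_{t+1}=1\mid x_t,\mathcal F_t)=\mu(x_t^\top\theta_*),\qquad \mathcal F_t=\sigma\big(\mathcal F_0,(x_s,r_{s+1})_{1\le s\le t-1}\big),$$ where $\mathcal F_0$ is prior knowledge. Let $x_*^t\in\arg\max_{x\in\mathcal X_t}\mu(x^\top\theta_*)$ (assumed to exist), let $R_T=\sum_{t=1}^T\big(\mu(\theta_*^\top x_*^t)-\mu(\theta_*^\top x_t)\big)$ be the pseudo-regret, let $\mathcal X$ be the set of all arms that may be presented at some round, and let $\kappa=\sup_{x\in\mathcal X,\theta\in\Theta}1/\dot\mu(x^\top\theta)$. For $\lambda>0$ and $\delta\in(0,1]$ put $$g_t(\theta)=\sum_{s=1}^{t-1}\mu(x_s^\top\theta)x_s+\lambda\theta,\quad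 \mathbf H_t(\theta)=\sum_{s=1}^{t-1}\dot\mu(x_s^\top\theta)x_sx_s^\top+\lambda \mathbf I_d,\quad \mathbf V_t=\sum_{s=1}^{t-1}x_sx_s^\top+\kappa\lambda \mathbf I_d,$$ $$\gamma_t(\delta)=\sqrt\lambda\Big(S+\tfrac12\Big)+\frac{2}{\sqrt\lambda}\log\Big(\frac{2^d}{\delta}\Big(1+\frac{Lt}{d\lambda}\Big)^{d/2}\Big),$$ and $\|x\|_{\mathbf M}=\sqrt{x^\top\mathbf Mx}$. Let $\hat\theta_t$ be the maximizer over $\mathbb R^d$ of the regularized log-likelihood $$\sum_{s=1}^{t-1}\big[r_{s+1}\log\mu(x_s^\top\theta)+(1-r_{s+1})\log(1-\mu(x_s^\top\theta))\big]-\frac\lambda2\|\theta\|_2^2 .$$ **Algorithm.** At each round $t\ge1$ the agent computes some $\theta_t^{(1)}\in\arg\min_{\theta\in\Theta}\|g_t(\theta)-g_t(\hat\theta_t)\|_{\mathbf H_t^{-1}(\theta)}$ and plays some $$x_t\in\arg\max_{x\in\mathcal X_t}\ \mu(x^\top\theta_t^{(1)})+L\sqrt{4+8S}\,\sqrt\kappa\,\gamma_t(\delta)\,\|x\|_{\mathbf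 V_t^{-1}}$$ (assumed to exist). **Theorem.** (i) With probability at least $1-\delta$, for all $T\ge1$, $$R_T\le C_1L\sqrt\kappa\,\gamma_T(\delta)\sqrt T,\qquad C_1=\sqrt{32\,d(1+2S)\max\Big(1,\frac1{\kappa\lambda}\Big)\log\Big(1+\frac{T}{\kappa\lambda d}\Big)} .$$ (ii) If the algorithm is run with $\lambda=d\log T$ for a horizon $T\ge2$, then with probability at least $1-\delta$ $$R_T\le C(S,\delta)\,\sqrt\kappa\; d\,\sqrt T\,\log T,$$ where $C(S,\delta)$ depends only on $S$ and $\delta$ (not on $d$, $T$, $\kappa$, $\Theta$, $\theta_*$ or the arm sets). -/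

import Mathlib

open MeasureTheory ProbabilityTheory

noncomputable section

/-- The parameter / feature space `ℝ^d` with its Euclidean structure. -/
abbrev Vec (d : ℕ) : Type := EuclideanSpace ℝ (Fin d)

/-- The upper bound `L = 1/4` on the first derivative of the sigmoid. -/
def sigmoidL : ℝ := 1 / 4

/-- The weighted norm `‖x‖_M = √(xᵀ M x)`. -/
def wnorm {d : ℕ} (M : Matrix (Fin d) (Fin d) ℝ) (x : Vec d) : ℝ :=
  Real.sqrt (x.ofLp ⬝ᵥ M.mulVec x.ofLp)

/-- The rank-one matrix `x xᵀ`. -/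
def outer {d : ℕ} (x : Vec d) : Matrix (Fin d) (Fin d) ℝ :=
  Matrix.vecMulVec x.ofLp x.ofLp

/-- The information available before round `t`: the prior knowledge `m₀` together with the
arms `x_s` and rewards `r_{s+1}` for `1 ≤ s ≤ t - 1`. -/
@[reducible] def history {Ω : Type*} {d : ℕ} (m₀ : MeasurableSpace Ω) (x : ℕ → Ω → Vec d)
    (r : ℕ → Ω → ℝ) (t : ℕ) : MeasurableSpace Ω :=
  m₀ ⊔ ⨆ s ∈ Finset.Ico 1 t,
    (MeasurableSpace.comap (x s) inferInstance ⊔ MeasurableSpace.comap (r (s + 1)) inferInstance)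

/-- A logistic bandit problem in `ℝ^d` together with the arms played and the rewards received,
on a probability space `(Ω, P)`. Rounds are `t = 1, 2, …`; the reward of round `t` is `r (t+1)`.
The action sets may be random (they depend on the context). -/
structure LogisticBandit (d : ℕ) {Ω : Type*} [mΩ : MeasurableSpace Ω] (P : Measure Ω) where
  /-- the set of admissible parameters -/
  Θ : Set (Vec d)
  /-- the unknown parameter -/
  θstar : Vec d
  /-- the action set presented at round `t` -/
  arms : ℕ → Ω → Set (Vec d)
  /-- the arm played at round `t` -/
  x : ℕ → Ω → Vec d
  /-- an optimal arm of round `t` -/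
  xstar : ℕ → Ω → Vec d
  /-- the rewards, `r (t + 1)` being received at round `t` -/
  r : ℕ → Ω → ℝ
  /-- the prior knowledge -/
  prior : MeasurableSpace Ω
  prior_le : prior ≤ mΩ
  isCompact_Θ : IsCompact Θ
  θstar_mem : θstar ∈ Θ
  norm_le_one : ∀ t, 1 ≤ t → ∀ ω, ∀ a ∈ arms t ω, ‖a‖ ≤ 1
  x_mem : ∀ t, 1 ≤ t → ∀ ω, x t ω ∈ arms t ω
  measurable_x : ∀ t, 1 ≤ t → Measurable[mΩ] (x t)
  xstar_mem : ∀ t, 1 ≤ t → ∀ ω, xstar t ω ∈ arms t ω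
  isMaxOn_xstar : ∀ t, 1 ≤ t → ∀ ω,
    IsMaxOn (fun a : Vec d => Real.sigmoid (inner ℝ a θstar)) (arms t ω) (xstar t ω)
  measurable_r : ∀ t, 1 ≤ t → Measurable[mΩ] (r (t + 1))
  r_binary : ∀ t, 1 ≤ t → ∀ ω, r (t + 1) ω = 0 ∨ r (t + 1) ω = 1
  /-- `P(r_{t+1} = 1 | x_t, F_t) = μ(x_tᵀ θ_*)` almost surely -/
  reward_model : ∀ t, 1 ≤ t →
    P⟦{ω | r (t + 1) ω = 1} |
        history prior x r t ⊔ MeasurableSpace.comap (x t) inferInstance⟧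
      =ᵐ[P] fun ω => Real.sigmoid (inner ℝ (x t ω) θstar)

namespace LogisticBandit

variable {d : ℕ} {Ω : Type*} [MeasurableSpace Ω] {P : Measure Ω}

/-- `S = max_{θ ∈ Θ} ‖θ‖₂`. -/
def S (B : LogisticBandit d P) : ℝ := sSup ((fun θ : Vec d => ‖θ‖) '' B.Θ)

/-- The set `𝒳` of all arms which may be presented at some round. -/
def allArms (B : LogisticBandit d P) : Set (Vec d) :=
  {a | ∃ t : ℕ, 1 ≤ t ∧ ∃ ω : Ω, a ∈ B.arms t ω}

/-- `κ = sup_{a ∈ 𝒳, θ ∈ Θ} 1 / μ'(aᵀ θ)`. -/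
def kappa (B : LogisticBandit d P) : ℝ :=
  sSup {k : ℝ | ∃ a ∈ B.allArms, ∃ θ ∈ B.Θ, k = 1 / deriv Real.sigmoid (inner ℝ a θ)}

/-- The cumulative pseudo-regret `R_T = ∑_{t=1}^T (μ(θ_*ᵀ x_*^t) - μ(θ_*ᵀ x_t))`. -/
def regret (B : LogisticBandit d P) (T : ℕ) (ω : Ω) : ℝ :=
  ∑ t ∈ Finset.Icc 1 T,
    (Real.sigmoid (inner ℝ B.θstar (B.xstar t ω)) - Real.sigmoid (inner ℝ B.θstar (B.x t ω)))

/-- The regularized log-likelihood `ℒ_t^λ(θ)`. -/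
def logLik (B : LogisticBandit d P) (lam : ℝ) (t : ℕ) (ω : Ω) (θ : Vec d) : ℝ :=
  ∑ s ∈ Finset.Ico 1 t,
    (B.r (s + 1) ω * Real.log (Real.sigmoid (inner ℝ (B.x s ω) θ))
      + (1 - B.r (s + 1) ω) * Real.log (1 - Real.sigmoid (inner ℝ (B.x s ω) θ)))
    - lam / 2 * ‖θ‖ ^ 2

/-- `g_t(θ) = ∑_{s=1}^{t-1} μ(x_sᵀ θ) x_s + λ θ`. -/
def g (B : LogisticBandit d P) (lam : ℝ) (t : ℕ) (ω : Ω) (θ : Vec d) : Vec d :=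
  ∑ s ∈ Finset.Ico 1 t, Real.sigmoid (inner ℝ (B.x s ω) θ) • B.x s ω + lam • θ

/-- `H_t(θ) = ∑_{s=1}^{t-1} μ'(x_sᵀ θ) x_s x_sᵀ + λ I_d`. -/
def H (B : LogisticBandit d P) (lam : ℝ) (t : ℕ) (ω : Ω) (θ : Vec d) :
    Matrix (Fin d) (Fin d) ℝ :=
  ∑ s ∈ Finset.Ico 1 t, deriv Real.sigmoid (inner ℝ (B.x s ω) θ) • outer (B.x s ω)
    + lam • (1 : Matrix (Fin d) (Fin d) ℝ)

/-- `V_t = ∑_{s=1}^{t-1} x_s x_sᵀ + κ λ I_d`. -/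
def V (B : LogisticBandit d P) (lam : ℝ) (t : ℕ) (ω : Ω) : Matrix (Fin d) (Fin d) ℝ :=
  ∑ s ∈ Finset.Ico 1 t, outer (B.x s ω) + (B.kappa * lam) • (1 : Matrix (Fin d) (Fin d) ℝ)

/-- `γ_t(δ) = √λ (S + 1/2) + (2/√λ) log((2^d/δ) (1 + L t/(d λ))^{d/2})`. -/
def gam (B : LogisticBandit d P) (lam δ : ℝ) (t : ℕ) : ℝ :=
  Real.sqrt lam * (B.S + 1 / 2)
    + 2 / Real.sqrt lam *
      Real.log ((2 : ℝ) ^ d / δ * (1 + sigmoidL * t / (d * lam)) ^ ((d : ℝ) / 2))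

/-- The exploration bonus `ε_{t,1}(a) = L √(4 + 8 S) √κ γ_t(δ) ‖a‖_{V_t⁻¹}`. -/
def bonus (B : LogisticBandit d P) (lam δ : ℝ) (t : ℕ) (ω : Ω) (a : Vec d) : ℝ :=
  sigmoidL * Real.sqrt (4 + 8 * B.S) * Real.sqrt B.kappa * B.gam lam δ t
    * wnorm (B.V lam t ω)⁻¹ a

/-- The quantity `‖g_t(θ) - g_t(θ')‖_{H_t(θ)⁻¹}`, minimized over `θ ∈ Θ` in the projection step. -/
def projLoss (B : LogisticBandit d P) (lam : ℝ) (t : ℕ) (ω : Ω) (θ' θ : Vec d) : ℝ :=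
  wnorm (B.H lam t ω θ)⁻¹ (B.g lam t ω θ - B.g lam t ω θ')

/-- The arms of `B` are played by the modified GLM-UCB algorithm with regularization `λ` and
confidence level `δ`: at each round, with `θ̂_t` the maximum likelihood estimator and `θ_t` a
projection of it on `Θ`, the arm `x_t` maximizes `μ(aᵀ θ_t) + ε_{t,1}(a)` over the action set. -/
def PlayedByGLMUCB (B : LogisticBandit d P) (lam δ : ℝ) : Prop :=
  ∀ t : ℕ, 1 ≤ t → ∀ ω : Ω, ∃ θhat θproj : Vec d,
    IsMaxOn (B.logLik lam t ω) Set.univ θhat ∧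
    θproj ∈ B.Θ ∧
    IsMinOn (B.projLoss lam t ω θhat) B.Θ θproj ∧
    IsMaxOn (fun a : Vec d => Real.sigmoid (inner ℝ a θproj) + B.bonus lam δ t ω a)
      (B.arms t ω) (B.x t ω)

/-- `C₁ = √(32 d (1 + 2S) max(1, 1/(κλ)) log(1 + T/(κ λ d)))`. -/
def C₁ (B : LogisticBandit d P) (lam : ℝ) (T : ℕ) : ℝ :=
  Real.sqrt (32 * d * (1 + 2 * B.S) * max 1 (1 / (B.kappa * lam))
    * Real.log (1 + T / (B.kappa * lam * d)))

end LogisticBandit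

/-- The property `E` holds with probability at least `p`: it holds on a measurable event of
probability at least `p`. -/
def HoldsWithProb {Ω : Type*} [MeasurableSpace Ω] (P : Measure Ω) (p : ℝ) (E : Ω → Prop) : Prop :=
  ∃ A : Set Ω, MeasurableSet A ∧ ENNReal.ofReal p ≤ P A ∧ ∀ ω ∈ A, E ω

end

/-! The proof separates one random event from a deterministic argument carried out on that event.

The event controls the centred score `B.score t`. For `‖ξ‖ ≤ 1`, the Bernstein bound
`bernoulli_mgf_le` makes exp(⟨ξ, score⟩ - ξᵀ H_t(θ_*) ξ) a nonnegative supermartingale. Averaging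
over ξ in the unit ball (`mixture`) keeps this property, and Ville's inequality
(`mul_measure_exists_lt_le`) bounds the average for all t at once. Conversely, a small mixture
forces a small score: recentre the integral at a point of norm at most 1/2, discard the odd part of
the exponent by symmetry, and compare two Gaussian masses (`inner_le_of_mixture_le`). The comparison
costs the factor 2^d √det H / λ^{d/2}, and the determinant is bounded by the trace. With the
first-order condition for θ̂ this yields ‖g_t(θ_*) - g_t(θ̂)‖ ≤ γ_t in the norm dual to H_t(θ_*)
(`wnorm_g_sub_le_gam`).

On the event, everything passes through the scalar D = ⟨g_t(θ_*) - g_t(θ), θ_* - θ⟩, where θ is the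
projected estimator. Self-concordance bounds the H-norms of θ_* - θ, at θ and at θ_*, by √((1+2S)
D); the definition of κ bounds the V-norm by √(κ D). Splitting D at θ̂ gives D ≤ 2γ √((1+2S) D), so
√D ≤ √(4+8S) γ (`abs_inner_sub_le`). No mean-value matrix between θ and θ_* is needed. Optimism then
bounds each round's regret by twice the bonus, and Cauchy–Schwarz with the elliptical potential
lemma sums the bonuses.

Part (ii) is the same bound evaluated at λ = d log T, where κλ ≥ 1 and both `C₁` and `gam` are of
order √λ. -/

noncomputable section

/-! ### Scalar inequalities: sigmoid, Bernoulli moment generating function, logarithm. -/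

section Scalar

theorem deriv_sigmoid_apply (a : ℝ) :
    deriv Real.sigmoid a = Real.sigmoid a * (1 - Real.sigmoid a) := by
  rw [Real.deriv_sigmoid]

theorem deriv_sigmoid_pos (a : ℝ) : 0 < deriv Real.sigmoid a := by
  rw [deriv_sigmoid_apply]
  exact mul_pos (Real.sigmoid_pos a) (sub_pos.2 (Real.sigmoid_lt_one a))

theorem deriv_sigmoid_le (a : ℝ) : deriv Real.sigmoid a ≤ 1 / 4 := by
  rw [deriv_sigmoid_apply]
  nlinarith [sq_nonneg (Real.sigmoid a - 1 / 2)]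

theorem deriv_sigmoid_neg (a : ℝ) : deriv Real.sigmoid (-a) = deriv Real.sigmoid a := by
  simp only [deriv_sigmoid_apply, Real.sigmoid_neg]
  ring

/-- Self-concordance of the logistic function, integrated along a segment. -/
theorem deriv_sigmoid_mul_sub_le_of_le {a b : ℝ} (h : a ≤ b) :
    deriv Real.sigmoid a * (b - a) ≤ (1 + (b - a)) * (Real.sigmoid b - Real.sigmoid a) := by
  have hp := Real.sigmoid_pos a
  have hq : 0 < 1 - Real.sigmoid a := sub_pos.2 (Real.sigmoid_lt_one a)
  have key : Real.sigmoid b - Real.sigmoid a =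
      Real.sigmoid a * Real.sigmoid b * (Real.exp (-a) - Real.exp (-b)) := by
    have h1 := Real.exp_pos (-a)
    have h2 := Real.exp_pos (-b)
    simp only [Real.sigmoid_def]
    field_simp
    ring
  have e1 : 1 - Real.sigmoid a = Real.sigmoid a * Real.exp (-a) := by
    rw [Real.sigmoid_mul_rexp_neg, Real.sigmoid_neg]
  have e2 : Real.exp (-b) = Real.exp (-a) * Real.exp (-(b - a)) := by
    rw [← Real.exp_add]; ring_nf
  -- This is the only analytic input: after the factorization `key`, the claim reduces to u ≤ (1 +
  -- u)(1 - e^{-u}) with u = b - a, together with σ(a) ≤ σ(b).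
  have e3 : Real.exp (-(b - a)) * (1 + (b - a)) ≤ 1 := by
    have := Real.add_one_le_exp (b - a)
    calc _ ≤ Real.exp (-(b - a)) * Real.exp (b - a) := by gcongr; linarith
      _ = 1 := by rw [← Real.exp_add]; simp
  have hab := Real.sigmoid_le h
  rw [deriv_sigmoid_apply, key, e1, e2]
  have hD : 0 ≤ b - a := sub_nonneg.2 h
  have hE := Real.exp_pos (-a)
  calc Real.sigmoid a * (Real.sigmoid a * Real.exp (-a)) * (b - a)
      ≤ Real.sigmoid a * (Real.sigmoid b * Real.exp (-a)) * (b - a) := by gcongr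
    _ ≤ Real.sigmoid a * (Real.sigmoid b * Real.exp (-a)) *
        ((1 + (b - a)) - Real.exp (-(b - a)) * (1 + (b - a))) := by
      have := Real.sigmoid_pos b
      refine mul_le_mul_of_nonneg_left ?_ (by positivity)
      linarith
    _ = _ := by ring

/-- The symmetry σ(-z) = 1 - σ(z) removes the order assumption from the one-sided inequality. Summed
over rounds with `D = 2S`, this compares the quadratic form of H with the monotonicity of g. -/
theorem deriv_sigmoid_mul_sq_le {a b D : ℝ} (h : |b - a| ≤ D) :
    deriv Real.sigmoid a * (b - a) ^ 2 ≤
      (1 + D) * ((Real.sigmoid b - Real.sigmoid a) * (b - a)) := by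
  rcases le_total a b with hab | hab
  · have h1 := deriv_sigmoid_mul_sub_le_of_le hab
    have h2 := Real.sigmoid_le hab
    rw [abs_of_nonneg (by linarith)] at h
    calc deriv Real.sigmoid a * (b - a) ^ 2 = deriv Real.sigmoid a * (b - a) * (b - a) := by ring
      _ ≤ (1 + (b - a)) * (Real.sigmoid b - Real.sigmoid a) * (b - a) := by
        gcongr
      _ = (1 + (b - a)) * ((Real.sigmoid b - Real.sigmoid a) * (b - a)) := by ring
      _ ≤ _ := by
        have : 0 ≤ (Real.sigmoid b - Real.sigmoid a) * (b - a) :=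
          mul_nonneg (by linarith) (by linarith)
        gcongr
  · have h1 := deriv_sigmoid_mul_sub_le_of_le (neg_le_neg hab)
    have h2 := Real.sigmoid_le hab
    rw [abs_of_nonpos (by linarith)] at h
    rw [deriv_sigmoid_neg, Real.sigmoid_neg, Real.sigmoid_neg] at h1
    calc deriv Real.sigmoid a * (b - a) ^ 2
        = deriv Real.sigmoid a * (-b - -a) * (a - b) := by ring
      _ ≤ (1 + (-b - -a)) * (1 - Real.sigmoid b - (1 - Real.sigmoid a)) * (a - b) := by
        gcongr
      _ = (1 + (a - b)) * ((Real.sigmoid b - Real.sigmoid a) * (b - a)) := by ring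
      _ ≤ _ := by
        have : 0 ≤ (Real.sigmoid b - Real.sigmoid a) * (b - a) :=
          mul_nonneg_of_nonpos_of_nonpos (by linarith) (by linarith)
        gcongr; linarith

theorem sigmoid_sub_le_of_le {a b : ℝ} (h : a ≤ b) :
    Real.sigmoid b - Real.sigmoid a ≤ 1 / 4 * (b - a) :=
  Convex.image_sub_le_mul_sub_of_deriv_le convex_univ continuous_sigmoid.continuousOn
    differentiable_sigmoid.differentiableOn (fun x _ => deriv_sigmoid_le x)
    a (Set.mem_univ _) b (Set.mem_univ _) h

theorem sigmoid_sub_le (a b : ℝ) : Real.sigmoid b - Real.sigmoid a ≤ 1 / 4 * |b - a| := by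
  rcases le_total a b with h | h
  · rw [abs_of_nonneg (by linarith)]; exact sigmoid_sub_le_of_le h
  · have := Real.sigmoid_le h
    have := abs_nonneg (b - a)
    linarith

theorem mul_sub_le_sigmoid_sub {a b c : ℝ} (h : a ≤ b) (ha : c ≤ deriv Real.sigmoid a)
    (hb : c ≤ deriv Real.sigmoid b) : c * (b - a) ≤ Real.sigmoid b - Real.sigmoid a := by
  refine Convex.mul_sub_le_image_sub_of_le_deriv (convex_Icc a b)
    continuous_sigmoid.continuousOn
    differentiable_sigmoid.differentiableOn (fun x hx => ?_)
    a (Set.left_mem_Icc.2 h) b (Set.right_mem_Icc.2 h) h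
  have hx' := interior_subset hx
  have h1 := Real.sigmoid_le hx'.1
  have h2 := Real.sigmoid_le hx'.2
  rw [deriv_sigmoid_apply] at *
  by_contra! hlt
  -- As σ' = σ(1 - σ), one has σ'(x) - σ'(a) = (σ(x) - σ(a))(1 - σ(a) - σ(x)). In the first case
  -- σ'(a) ≤ σ'(x); in the second σ(x) + σ(b) ≥ 1, so σ'(b) ≤ σ'(x).
  rcases le_total (Real.sigmoid a + Real.sigmoid x) 1 with h3 | h3 <;> nlinarith

/-- A lower bound on the derivative of the sigmoid at both ends of a segment makes the sigmoid
strongly monotone along the segment, since its derivative is unimodal. -/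
theorem mul_sq_le_sigmoid_sub_mul {a b c : ℝ} (ha : c ≤ deriv Real.sigmoid a)
    (hb : c ≤ deriv Real.sigmoid b) :
    c * (b - a) ^ 2 ≤ (Real.sigmoid b - Real.sigmoid a) * (b - a) := by
  rcases le_total a b with h | h
  · nlinarith [mul_sub_le_sigmoid_sub h ha hb]
  · nlinarith [mul_sub_le_sigmoid_sub h hb ha]

/-- The Bernstein bound on the moment generating function of a centred Bernoulli variable. -/
theorem bernoulli_mgf_le {p η : ℝ} (hp0 : 0 ≤ p) (hp1 : p ≤ 1) (hη : |η| ≤ 1) :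
    p * Real.exp (η * (1 - p)) + (1 - p) * Real.exp (-(η * p)) ≤
      Real.exp (p * (1 - p) * η ^ 2) := by
  have hq : 0 ≤ 1 - p := by linarith
  -- The restriction |x| ≤ 1 is why the mixture is taken over the unit ball. Averaging removes the
  -- linear terms, and the quadratic ones add up to the variance p(1 - p) times η².
  have key : ∀ x : ℝ, |x| ≤ 1 → Real.exp x ≤ 1 + x + x ^ 2 := fun x hx => by
    have := (abs_le.1 (Real.abs_exp_sub_one_sub_id_le hx)).2
    linarith
  have h1 : |η * (1 - p)| ≤ 1 := by
    rw [abs_mul, abs_of_nonneg hq]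
    exact mul_le_one₀ hη hq (by linarith)
  have h2 : |-(η * p)| ≤ 1 := by
    rw [abs_neg, abs_mul, abs_of_nonneg hp0]
    exact mul_le_one₀ hη hp0 hp1
  calc _ ≤ p * (1 + η * (1 - p) + (η * (1 - p)) ^ 2) +
        (1 - p) * (1 + -(η * p) + (-(η * p)) ^ 2) := by
        gcongr
        · exact key _ h1
        · exact key _ h2
    _ = p * (1 - p) * η ^ 2 + 1 := by ring
    _ ≤ _ := Real.add_one_le_exp _

/-- Rescale to z = u/c ≤ 1, where log(1 + z) ≥ z/(1 + z) ≥ z/2. In the potential lemma c = max(1,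
1/(κλ)), which puts that maximum into `C₁`. -/
theorem le_two_mul_log_one_add {u c : ℝ} (hu : 0 ≤ u) (hc : 1 ≤ c) (huc : u ≤ c) :
    u ≤ 2 * c * Real.log (1 + u) := by
  have h := Real.one_sub_inv_le_log_of_pos (x := 1 + u / c) (by positivity)
  have hc0 : 0 < c := by linarith
  have h1 : u / c ≤ 1 := (div_le_one hc0).2 huc
  have h0 : 0 ≤ u / c := by positivity
  have h2 : u / c / 2 ≤ 1 - (1 + u / c)⁻¹ := by
    have e : 1 - (1 + u / c)⁻¹ = (u / c) / (1 + u / c) := by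
      have : (1 + u / c) ≠ 0 := by positivity
      field_simp
      ring
    rw [e]
    gcongr
    linarith
  have h3 : Real.log (1 + u / c) ≤ Real.log (1 + u) := by
    apply Real.log_le_log (by positivity)
    gcongr
    exact div_le_self hu hc
  calc u = 2 * c * (u / c / 2) := by field_simp
    _ ≤ _ := by gcongr; linarith

end Scalar

/-! ### Quadratic forms, dual norms and determinants of positive definite matrices. -/

section QuadraticForm

variable {d : ℕ}

/-- The quadratic form `xᵀ M x`. -/
def quad (M : Matrix (Fin d) (Fin d) ℝ) (x : Vec d) : ℝ := x.ofLp ⬝ᵥ M.mulVec x.ofLp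

theorem wnorm_eq_sqrt_quad (M : Matrix (Fin d) (Fin d) ℝ) (x : Vec d) :
    wnorm M x = Real.sqrt (quad M x) := rfl

theorem wnorm_nonneg (M : Matrix (Fin d) (Fin d) ℝ) (x : Vec d) : 0 ≤ wnorm M x :=
  Real.sqrt_nonneg _

theorem inner_eq_dotProduct (x y : Vec d) : inner ℝ x y = x.ofLp ⬝ᵥ y.ofLp := by
  rw [EuclideanSpace.inner_eq_star_dotProduct, dotProduct_comm]
  simp

theorem quad_add (M N : Matrix (Fin d) (Fin d) ℝ) (x : Vec d) :
    quad (M + N) x = quad M x + quad N x := by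
  simp [quad, Matrix.add_mulVec, dotProduct_add]

theorem quad_smul (c : ℝ) (M : Matrix (Fin d) (Fin d) ℝ) (x : Vec d) :
    quad (c • M) x = c * quad M x := by
  simp [quad, Matrix.smul_mulVec, dotProduct_smul]

theorem quad_sum {ι : Type*} (I : Finset ι) (M : ι → Matrix (Fin d) (Fin d) ℝ) (x : Vec d) :
    quad (∑ i ∈ I, M i) x = ∑ i ∈ I, quad (M i) x := by
  simp [quad, Matrix.sum_mulVec, dotProduct_sum]

theorem quad_one (x : Vec d) : quad 1 x = ‖x‖ ^ 2 := by
  rw [quad, Matrix.one_mulVec, ← inner_eq_dotProduct, real_inner_self_eq_norm_sq]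

theorem quad_outer (a x : Vec d) : quad (outer a) x = inner ℝ a x ^ 2 := by
  rw [quad, outer, Matrix.vecMulVec_mulVec, inner_eq_dotProduct, dotProduct_smul]
  simp [dotProduct_comm, sq]

theorem trace_outer (a : Vec d) : (outer a).trace = ‖a‖ ^ 2 := by
  rw [outer, Matrix.trace_vecMulVec, ← inner_eq_dotProduct, real_inner_self_eq_norm_sq]

theorem isHermitian_outer (a : Vec d) : (outer a).IsHermitian := by
  ext i j
  simp [outer, Matrix.vecMulVec_apply, mul_comm]

theorem isHermitian_sum_smul_outer_add {ι : Type*} (I : Finset ι) (w : ι → ℝ) (x : ι → Vec d)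
    (c : ℝ) : (∑ i ∈ I, w i • outer (x i) + c • (1 : Matrix (Fin d) (Fin d) ℝ)).IsHermitian := by
  have hsmul : ∀ (k : ℝ) (M : Matrix (Fin d) (Fin d) ℝ), M.IsHermitian → (k • M).IsHermitian :=
    fun k M hM => by
      unfold Matrix.IsHermitian at *
      rw [Matrix.conjTranspose_smul, hM]
      simp
  refine Matrix.IsHermitian.add ?_ (hsmul _ _ Matrix.isHermitian_one)
  unfold Matrix.IsHermitian
  rw [Matrix.conjTranspose_sum]
  exact Finset.sum_congr rfl fun i _ => hsmul _ _ (isHermitian_outer _)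

theorem quad_sum_smul_outer_add {ι : Type*} (I : Finset ι) (w : ι → ℝ) (x : ι → Vec d)
    (c : ℝ) (v : Vec d) :
    quad (∑ i ∈ I, w i • outer (x i) + c • (1 : Matrix (Fin d) (Fin d) ℝ)) v =
      ∑ i ∈ I, w i * inner ℝ (x i) v ^ 2 + c * ‖v‖ ^ 2 := by
  simp only [quad_add, quad_sum, quad_smul, quad_outer, quad_one]

theorem trace_sum_smul_outer_add {ι : Type*} (I : Finset ι) (w : ι → ℝ) (x : ι → Vec d) (c : ℝ) :
    (∑ i ∈ I, w i • outer (x i) + c • (1 : Matrix (Fin d) (Fin d) ℝ)).trace =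
      ∑ i ∈ I, w i * ‖x i‖ ^ 2 + c * d := by
  simp only [Matrix.trace_add, Matrix.trace_sum, Matrix.trace_smul, trace_outer, Matrix.trace_one,
    smul_eq_mul, Fintype.card_fin]

theorem le_quad_sum_smul_outer_add {ι : Type*} (I : Finset ι) {w : ι → ℝ}
    (hw : ∀ i ∈ I, 0 ≤ w i) (x : ι → Vec d) (c : ℝ) (v : Vec d) :
    c * ‖v‖ ^ 2 ≤ quad (∑ i ∈ I, w i • outer (x i) + c • (1 : Matrix (Fin d) (Fin d) ℝ)) v := by
  rw [quad_sum_smul_outer_add]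
  have := Finset.sum_nonneg fun i hi => mul_nonneg (hw i hi) (sq_nonneg (inner ℝ (x i) v))
  linarith

theorem posDef_of_le_quad {M : Matrix (Fin d) (Fin d) ℝ} (hM : M.IsHermitian) {c : ℝ}
    (hc : 0 < c) (h : ∀ v : Vec d, c * ‖v‖ ^ 2 ≤ quad M v) : M.PosDef := by
  refine Matrix.PosDef.of_dotProduct_mulVec_pos hM fun v hv => ?_
  have h1 := h (WithLp.toLp 2 v)
  have h2 : 0 < ‖(WithLp.toLp 2 v : Vec d)‖ := by
    rw [norm_pos_iff]
    simpa using hv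
  have h3 : 0 < c * ‖(WithLp.toLp 2 v : Vec d)‖ ^ 2 := by positivity
  simpa [quad] using h3.trans_le h1

theorem posDef_sum_smul_outer_add {ι : Type*} (I : Finset ι) {w : ι → ℝ}
    (hw : ∀ i ∈ I, 0 ≤ w i) (x : ι → Vec d) {c : ℝ} (hc : 0 < c) :
    (∑ i ∈ I, w i • outer (x i) + c • (1 : Matrix (Fin d) (Fin d) ℝ)).PosDef :=
  posDef_of_le_quad (isHermitian_sum_smul_outer_add I w x c) hc
    (le_quad_sum_smul_outer_add I hw x c)

theorem Matrix.PosDef.quad_nonneg {M : Matrix (Fin d) (Fin d) ℝ} (hM : M.PosDef) (v : Vec d) :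
    0 ≤ quad M v := by
  simpa [quad] using hM.posSemidef.dotProduct_mulVec_nonneg v.ofLp

theorem quad_toLp_inv_mulVec {M : Matrix (Fin d) (Fin d) ℝ} (hM : M.PosDef) (x : Vec d) :
    quad M (WithLp.toLp 2 (M⁻¹.mulVec x.ofLp)) = quad M⁻¹ x := by
  have hu : IsUnit M.det := (Matrix.isUnit_iff_isUnit_det M).1 hM.isUnit
  simp [quad, Matrix.mulVec_mulVec, Matrix.mul_nonsing_inv _ hu, dotProduct_comm]

theorem inner_toLp_inv_mulVec (M : Matrix (Fin d) (Fin d) ℝ) (x : Vec d) :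
    inner ℝ x (WithLp.toLp 2 (M⁻¹.mulVec x.ofLp)) = quad M⁻¹ x := by
  rw [inner_eq_dotProduct, quad]

/-- The weighted norms of a positive definite matrix and of its inverse are dual. -/
theorem inner_le_wnorm_inv_mul_wnorm {M : Matrix (Fin d) (Fin d) ℝ} (hM : M.PosDef)
    (x v : Vec d) : inner ℝ x v ≤ wnorm M⁻¹ x * wnorm M v := by
  have hu : IsUnit M.det := (Matrix.isUnit_iff_isUnit_det M).1 hM.isUnit
  -- Cauchy–Schwarz through the discriminant: the polynomial in c is the M-form of v - c M⁻¹x.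
  have hexp : ∀ c : ℝ, 0 ≤ quad M⁻¹ x * (c * c) + (-2 * inner ℝ x v) * c + quad M v := fun c => by
    have h := hM.quad_nonneg (v - c • WithLp.toLp 2 (M⁻¹.mulVec x.ofLp))
    have hsymm : (M⁻¹.mulVec x.ofLp) ⬝ᵥ M.mulVec v.ofLp = inner ℝ x v := by
      have ht : M.transpose = M := by simpa using hM.isHermitian.eq
      rw [Matrix.dotProduct_mulVec, ← Matrix.mulVec_transpose, ht, Matrix.mulVec_mulVec,
        Matrix.mul_nonsing_inv _ hu, Matrix.one_mulVec, inner_eq_dotProduct]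
    have hx : v.ofLp ⬝ᵥ M.mulVec (M⁻¹.mulVec x.ofLp) = inner ℝ x v := by
      rw [Matrix.mulVec_mulVec, Matrix.mul_nonsing_inv _ hu, Matrix.one_mulVec,
        inner_eq_dotProduct, dotProduct_comm]
    have hq : (M⁻¹.mulVec x.ofLp) ⬝ᵥ M.mulVec (M⁻¹.mulVec x.ofLp) = quad M⁻¹ x :=
      quad_toLp_inv_mulVec hM x
    have : quad M (v - c • WithLp.toLp 2 (M⁻¹.mulVec x.ofLp)) =
        quad M v - 2 * c * inner ℝ x v + c * c * quad M⁻¹ x := by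
      rw [← hq]
      simp only [quad, WithLp.ofLp_sub, WithLp.ofLp_smul, Matrix.mulVec_sub, Matrix.mulVec_smul,
        dotProduct_sub, sub_dotProduct, smul_dotProduct, dotProduct_smul, hsymm, hx, smul_eq_mul]
      ring
    rw [this] at h
    linarith
  have hd := discrim_le_zero hexp
  rw [discrim] at hd
  have h4 : inner ℝ x v ^ 2 ≤ quad M⁻¹ x * quad M v := by nlinarith
  rw [wnorm_eq_sqrt_quad, wnorm_eq_sqrt_quad, ← Real.sqrt_mul (hM.inv.quad_nonneg x)]
  exact Real.le_sqrt_of_sq_le h4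

/-- Converse half of duality: test at v = M⁻¹w, where both the pairing and the squared M-norm equal
‖w‖² in the norm of M⁻¹. -/
theorem wnorm_inv_le_of_inner_le {M : Matrix (Fin d) (Fin d) ℝ} (hM : M.PosDef) {w : Vec d}
    {c : ℝ} (hc : 0 ≤ c) (h : ∀ v : Vec d, inner ℝ w v ≤ c * wnorm M v) : wnorm M⁻¹ w ≤ c := by
  have h1 := h (WithLp.toLp 2 (M⁻¹.mulVec w.ofLp))
  rw [inner_toLp_inv_mulVec, wnorm_eq_sqrt_quad, quad_toLp_inv_mulVec hM, ← wnorm_eq_sqrt_quad,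
    ← Real.sq_sqrt (hM.inv.quad_nonneg w), ← wnorm_eq_sqrt_quad] at h1
  rcases (wnorm_nonneg M⁻¹ w).eq_or_lt with h0 | h0
  · rwa [← h0]
  · rw [sq] at h1
    exact le_of_mul_le_mul_right h1 h0

theorem quad_inv_le {M : Matrix (Fin d) (Fin d) ℝ} (hM : M.PosDef) {c : ℝ} (hc : 0 < c)
    (h : ∀ v : Vec d, c * ‖v‖ ^ 2 ≤ quad M v) (x : Vec d) : quad M⁻¹ x ≤ ‖x‖ ^ 2 / c := by
  have hw : wnorm M⁻¹ x ≤ ‖x‖ / Real.sqrt c := by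
    refine wnorm_inv_le_of_inner_le hM (by positivity) fun v => ?_
    have h1 : Real.sqrt c * ‖v‖ ≤ wnorm M v := by
      refine Real.le_sqrt_of_sq_le ?_
      rw [mul_pow, Real.sq_sqrt hc.le]
      exact h v
    have hs : 0 < Real.sqrt c := Real.sqrt_pos.2 hc
    calc inner ℝ x v ≤ ‖x‖ * ‖v‖ := real_inner_le_norm x v
      _ = ‖x‖ / Real.sqrt c * (Real.sqrt c * ‖v‖) := by field_simp
      _ ≤ _ := by gcongr
  have := pow_le_pow_left₀ (wnorm_nonneg _ _) hw 2
  rwa [wnorm_eq_sqrt_quad, Real.sq_sqrt (hM.inv.quad_nonneg x), div_pow, Real.sq_sqrt hc.le] at this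

/-- Matrix determinant lemma for a rank-one update; it makes log det V telescope. -/
theorem det_add_outer {M : Matrix (Fin d) (Fin d) ℝ} (hM : M.PosDef) (x : Vec d) :
    (M + outer x).det = M.det * (1 + quad M⁻¹ x) := by
  have hu : IsUnit M.det := (Matrix.isUnit_iff_isUnit_det M).1 hM.isUnit
  have h := Matrix.det_add_replicateCol_mul_replicateRow (ι := Unit) hu x.ofLp x.ofLp
  rw [← Matrix.vecMulVec_eq] at h
  have h1 : (1 + Matrix.replicateRow Unit x.ofLp * M⁻¹ * Matrix.replicateCol Unit x.ofLp).det =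
      1 + quad M⁻¹ x := by
    rw [Matrix.det_unique, Matrix.mul_assoc, quad, Matrix.add_apply, Matrix.one_apply_eq]
    congr 1
  rw [outer, h, h1]

/-- The arithmetic-geometric mean inequality for the eigenvalues of a positive definite matrix. -/
theorem Matrix.PosDef.det_le_trace_div_pow {M : Matrix (Fin d) (Fin d) ℝ} (hM : M.PosDef)
    (hd : 1 ≤ d) : M.det ≤ (M.trace / d) ^ d := by
  have hd0 : (d : ℝ) ≠ 0 := by positivity
  have hz : ∀ i ∈ Finset.univ, 0 ≤ hM.isHermitian.eigenvalues i := fun i _ =>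
    (hM.eigenvalues_pos i).le
  have hdet : M.det = ∏ i, hM.isHermitian.eigenvalues i := by
    simpa using hM.isHermitian.det_eq_prod_eigenvalues
  have htr : M.trace = ∑ i, hM.isHermitian.eigenvalues i := by
    simpa using hM.isHermitian.trace_eq_sum_eigenvalues
  have hpos : 0 < ∑ _i : Fin d, (1 : ℝ) := by
    simp only [Finset.sum_const, Finset.card_univ, Fintype.card_fin, nsmul_eq_mul, mul_one]
    positivity
  have h := Real.geom_mean_le_arith_mean Finset.univ (fun _ => 1) hM.isHermitian.eigenvalues
    (fun _ _ => zero_le_one) hpos hz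
  simp only [Real.rpow_one, one_mul, Finset.sum_const, Finset.card_univ, Fintype.card_fin,
    nsmul_eq_mul, mul_one, ← hdet, ← htr] at h
  calc M.det = (M.det ^ (d : ℝ)⁻¹) ^ d := by
        rw [Real.rpow_inv_natCast_pow hM.det_pos.le (by omega)]
    _ ≤ _ := pow_le_pow_left₀ (Real.rpow_nonneg hM.det_pos.le _) h d

/-- Factor M = BᵀB. The map B is the change of variables that turns an anisotropic Gaussian weight
into a radial one, with Jacobian √det M. -/
theorem exists_linearMap_norm_sq_eq_quad {M : Matrix (Fin d) (Fin d) ℝ} (hM : M.PosDef) :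
    ∃ f : Vec d →ₗ[ℝ] Vec d, (∀ v, ‖f v‖ ^ 2 = quad M v) ∧
      |LinearMap.det f| = Real.sqrt M.det := by
  open scoped MatrixOrder in
  obtain ⟨B, hB⟩ := CStarAlgebra.nonneg_iff_eq_star_mul_self.mp hM.posSemidef.nonneg
  refine ⟨B.toLpLin 2 2, fun v => ?_, ?_⟩
  · rw [← real_inner_self_eq_norm_sq, inner_eq_dotProduct, quad, hB, ← Matrix.mulVec_mulVec,
      Matrix.star_eq_conjTranspose, Matrix.conjTranspose_eq_transpose_of_trivial,
      Matrix.dotProduct_mulVec _ B.transpose, Matrix.vecMul_transpose]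
    simp
  · rw [LinearMap.det_toLpLin, hB, Matrix.det_mul, Matrix.star_eq_conjTranspose,
      Matrix.det_conjTranspose, star_trivial, Real.sqrt_mul_self_eq_abs]

end QuadraticForm

/-! ### From a bound on the mixture to a bound on the score. -/

section GaussianMixture

variable {d : ℕ}

@[fun_prop]
theorem continuous_quad (M : Matrix (Fin d) (Fin d) ℝ) : Continuous (quad M) := by
  unfold quad
  exact (PiLp.continuous_ofLp 2 _).dotProduct
    (Continuous.matrix_mulVec continuous_const (PiLp.continuous_ofLp 2 _))

theorem quad_neg (M : Matrix (Fin d) (Fin d) ℝ) (v : Vec d) : quad M (-v) = quad M v := by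
  simp [quad, Matrix.mulVec_neg]

theorem quad_smul_right (M : Matrix (Fin d) (Fin d) ℝ) (c : ℝ) (v : Vec d) :
    quad M (c • v) = c ^ 2 * quad M v := by
  simp [quad, Matrix.mulVec_smul]
  ring

/-- Averaging the integral with its image under v ↦ -v replaces e^ℓ by cosh ℓ ≥ 1, so an odd
exponent can only increase the mass of an even weight. -/
theorem lintegral_le_lintegral_exp_mul {ℓ : Vec d → ℝ} {w : Vec d → ENNReal}
    (hℓ : Measurable ℓ) (hw : Measurable w) (hodd : ∀ v, ℓ (-v) = -ℓ v)
    (heven : ∀ v, w (-v) = w v) :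
    ∫⁻ v, w v ≤ ∫⁻ v, ENNReal.ofReal (Real.exp (ℓ v)) * w v := by
  have hm : Measurable fun v => ENNReal.ofReal (Real.exp (ℓ v)) * w v := by fun_prop
  have hneg : ∫⁻ v, ENNReal.ofReal (Real.exp (-ℓ v)) * w v =
      ∫⁻ v, ENNReal.ofReal (Real.exp (ℓ v)) * w v := by
    rw [← lintegral_neg_eq_self (μ := (volume : Measure (Vec d)))
      (fun v => ENNReal.ofReal (Real.exp (ℓ v)) * w v)]
    simp only [hodd, heven]
  have h2 : 2 * ∫⁻ v, w v ≤ 2 * ∫⁻ v, ENNReal.ofReal (Real.exp (ℓ v)) * w v := by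
    calc 2 * ∫⁻ v, w v = ∫⁻ v, 2 * w v := (lintegral_const_mul _ hw).symm
      _ ≤ ∫⁻ v, (ENNReal.ofReal (Real.exp (ℓ v)) * w v +
          ENNReal.ofReal (Real.exp (-ℓ v)) * w v) := by
        refine lintegral_mono fun v => ?_
        simp only
        rw [← add_mul, ← ENNReal.ofReal_add (Real.exp_pos _).le (Real.exp_pos _).le]
        gcongr
        rw [show (2 : ENNReal) = ENNReal.ofReal 2 by simp]
        apply ENNReal.ofReal_le_ofReal
        have := Real.add_one_le_exp (ℓ v)
        have := Real.add_one_le_exp (-ℓ v)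
        linarith
      _ = _ := by rw [lintegral_add_left hm, hneg, two_mul]
  exact (ENNReal.mul_le_mul_iff_right (by simp) (by simp)).1 h2

/-- The average of the exponential process `exp (⟨ξ, s⟩ - ξᵀ M ξ)` over the unit ball. -/
def mixture (M : Matrix (Fin d) (Fin d) ℝ) (s : Vec d) : ENNReal :=
  ∫⁻ ξ in Metric.closedBall (0 : Vec d) 1, ENNReal.ofReal (Real.exp (inner ℝ ξ s - quad M ξ))

/-- Translate by ξ₀: the ball of radius 1/2 about ξ₀ lies in the unit ball, and the exponent splits
into its value at ξ₀, a linear term and -ξᵀMξ. -/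
theorem exp_mul_lintegral_le_mixture (M : Matrix (Fin d) (Fin d) ℝ) (s : Vec d) {ξ₀ : Vec d}
    (hξ₀ : ‖ξ₀‖ ≤ 1 / 2) :
    ENNReal.ofReal (Real.exp (inner ℝ ξ₀ s - quad M ξ₀)) *
      ∫⁻ ξ in Metric.closedBall (0 : Vec d) (1 / 2), ENNReal.ofReal (Real.exp (-quad M ξ)) ≤
      mixture M s := by
  set w : Vec d → ENNReal := (Metric.closedBall (0 : Vec d) (1 / 2)).indicator
    fun ξ => ENNReal.ofReal (Real.exp (-quad M ξ)) with hwdef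
  -- The terms of the translated exponent that are linear in ξ, hence odd; symmetrization removes
  -- them.
  set ℓ : Vec d → ℝ := fun ξ => inner ℝ ξ s - ξ₀.ofLp ⬝ᵥ M.mulVec ξ.ofLp
    - ξ.ofLp ⬝ᵥ M.mulVec ξ₀.ofLp with hℓdef
  have hℓ : Measurable ℓ := by
    have h0 := PiLp.continuous_ofLp 2 (fun _ : Fin d => ℝ)
    have h1 : Continuous fun ξ : Vec d => ξ₀.ofLp ⬝ᵥ M.mulVec ξ.ofLp :=
      continuous_const.dotProduct (Continuous.matrix_mulVec continuous_const h0)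
    have h2 : Continuous fun ξ : Vec d => ξ.ofLp ⬝ᵥ M.mulVec ξ₀.ofLp :=
      h0.dotProduct continuous_const
    have h3 : Continuous fun ξ : Vec d => (inner ℝ ξ s : ℝ) := by fun_prop
    exact ((h3.sub h1).sub h2).measurable
  have hw : Measurable w := by
    refine Measurable.indicator ?_ Metric.isClosed_closedBall.measurableSet
    have := (continuous_quad M).measurable
    fun_prop
  have hodd : ∀ v, ℓ (-v) = -ℓ v := fun v => by
    simp only [hℓdef, inner_neg_left, WithLp.ofLp_neg, Matrix.mulVec_neg, dotProduct_neg,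
      neg_dotProduct]
    ring
  have heven : ∀ v, w (-v) = w v := fun v => by
    simp only [hwdef, Set.indicator, mem_closedBall_zero_iff, norm_neg, quad_neg]
  have hsplit : ∀ ξ : Vec d, inner ℝ (ξ₀ + ξ) s - quad M (ξ₀ + ξ) =
      (inner ℝ ξ₀ s - quad M ξ₀) + (ℓ ξ + -quad M ξ) := fun ξ => by
    simp only [hℓdef, quad, inner_add_left, WithLp.ofLp_add, Matrix.mulVec_add, dotProduct_add,
      add_dotProduct]
    ring
  rw [mixture, ← lintegral_indicator Metric.isClosed_closedBall.measurableSet,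
    ← lintegral_indicator Metric.isClosed_closedBall.measurableSet,
    ← lintegral_add_left_eq_self ((Metric.closedBall (0 : Vec d) 1).indicator
      fun ξ => ENNReal.ofReal (Real.exp (inner ℝ ξ s - quad M ξ))) ξ₀]
  calc _ ≤ ENNReal.ofReal (Real.exp (inner ℝ ξ₀ s - quad M ξ₀)) *
        ∫⁻ v, ENNReal.ofReal (Real.exp (ℓ v)) * w v := by
        exact mul_le_mul' le_rfl (lintegral_le_lintegral_exp_mul hℓ hw hodd heven)
    _ = ∫⁻ v, ENNReal.ofReal (Real.exp (inner ℝ ξ₀ s - quad M ξ₀)) *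
          (ENNReal.ofReal (Real.exp (ℓ v)) * w v) := by
        rw [lintegral_const_mul _ (by fun_prop)]
    _ ≤ _ := by
        refine lintegral_mono fun v => ?_
        simp only [hwdef]
        by_cases hv : v ∈ Metric.closedBall (0 : Vec d) (1 / 2)
        · have hv' : ξ₀ + v ∈ Metric.closedBall (0 : Vec d) 1 := by
            rw [mem_closedBall_zero_iff] at *
            linarith [norm_add_le ξ₀ v]
          rw [Set.indicator_of_mem hv, Set.indicator_of_mem hv', hsplit, Real.exp_add,
            Real.exp_add, ENNReal.ofReal_mul (Real.exp_pos _).le,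
            ENNReal.ofReal_mul (Real.exp_pos _).le]
        · rw [Set.indicator_of_notMem hv]
          simp

theorem lintegral_comp_linearMap {f : Vec d →ₗ[ℝ] Vec d} (hf : LinearMap.det f ≠ 0)
    {φ : Vec d → ENNReal} (hφ : Measurable φ) :
    ∫⁻ ξ, φ (f ξ) = ENNReal.ofReal |(LinearMap.det f)⁻¹| * ∫⁻ u, φ u := by
  have hfm : Measurable f := f.continuous_of_finiteDimensional.measurable
  rw [← lintegral_map hφ hfm, Measure.map_linearMap_addHaar_eq_smul_addHaar _ hf,
    lintegral_smul_measure, smul_eq_mul]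

/-- Comparison of the mass of an isotropic Gaussian weight on the unit ball with the mass of a
narrower Gaussian weight on the ball of radius `1 / 2`. -/
theorem lintegral_exp_neg_le_mul_lintegral_exp_neg_quad {M : Matrix (Fin d) (Fin d) ℝ}
    (hM : M.PosDef) {c : ℝ} (hc : 0 < c) (h : ∀ v : Vec d, c * ‖v‖ ^ 2 ≤ quad M v) :
    ∫⁻ ξ in Metric.closedBall (0 : Vec d) 1, ENNReal.ofReal (Real.exp (-(c * ‖ξ‖ ^ 2))) ≤
      ENNReal.ofReal (2 ^ d * Real.sqrt M.det / Real.sqrt c ^ d) *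
        ∫⁻ ξ in Metric.closedBall (0 : Vec d) (1 / 2),
          ENNReal.ofReal (Real.exp (-quad M ξ)) := by
  obtain ⟨f, hf, hdet⟩ := exists_linearMap_norm_sq_eq_quad hM
  have hsc : 0 < Real.sqrt c := Real.sqrt_pos.2 hc
  have hsd : 0 < Real.sqrt M.det := Real.sqrt_pos.2 hM.det_pos
  -- Common reference weight. The scaling by √c/2 carries the unit ball to this ball while weakening
  -- the exponent from c to c/4, and produces the factor 2^d. The map `f` pulls this ball back into
  -- the ball of radius 1/2, because M ≥ c.
  set φ : Vec d → ENNReal := (Metric.closedBall (0 : Vec d) (Real.sqrt c / 2)).indicator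
    fun u => ENNReal.ofReal (Real.exp (-‖u‖ ^ 2)) with hφdef
  have hφ : Measurable φ :=
    Measurable.indicator (by fun_prop) Metric.isClosed_closedBall.measurableSet
  have hdf : LinearMap.det f ≠ 0 := by
    rw [← abs_pos, hdet]; exact hsd
  have hdg : LinearMap.det ((Real.sqrt c / 2) • (LinearMap.id : Vec d →ₗ[ℝ] Vec d)) =
      (Real.sqrt c / 2) ^ d := by
    simp [LinearMap.det_smul]
  have hdg0 : LinearMap.det ((Real.sqrt c / 2) • (LinearMap.id : Vec d →ₗ[ℝ] Vec d)) ≠ 0 := by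
    rw [hdg]; positivity
  have h1 : ∫⁻ ξ in Metric.closedBall (0 : Vec d) 1,
      ENNReal.ofReal (Real.exp (-(c * ‖ξ‖ ^ 2))) ≤
      ENNReal.ofReal ((2 / Real.sqrt c) ^ d) * ∫⁻ u, φ u := by
    have e : |(LinearMap.det ((Real.sqrt c / 2) • (LinearMap.id : Vec d →ₗ[ℝ] Vec d)))⁻¹| =
        (2 / Real.sqrt c) ^ d := by
      rw [hdg, abs_of_pos (by positivity), ← inv_pow, inv_div]
    rw [← e, ← lintegral_comp_linearMap hdg0 hφ,
      ← lintegral_indicator Metric.isClosed_closedBall.measurableSet]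
    refine lintegral_mono fun v => ?_
    by_cases hv : v ∈ Metric.closedBall (0 : Vec d) 1
    · have hn : ‖(Real.sqrt c / 2) • v‖ = Real.sqrt c / 2 * ‖v‖ := by
        rw [norm_smul, Real.norm_of_nonneg (by positivity)]
      have hv' : (Real.sqrt c / 2) • v ∈ Metric.closedBall (0 : Vec d) (Real.sqrt c / 2) := by
        rw [mem_closedBall_zero_iff] at *
        rw [hn]
        exact mul_le_of_le_one_right (by positivity) hv
      simp only [hφdef, LinearMap.smul_apply, LinearMap.id_apply]
      rw [Set.indicator_of_mem hv, Set.indicator_of_mem hv', hn, mul_pow, div_pow,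
        Real.sq_sqrt hc.le]
      gcongr
      nlinarith [sq_nonneg ‖v‖]
    · simp [Set.indicator_of_notMem hv]
  have h2 : ENNReal.ofReal ((Real.sqrt M.det)⁻¹) * ∫⁻ u, φ u ≤
      ∫⁻ ξ in Metric.closedBall (0 : Vec d) (1 / 2), ENNReal.ofReal (Real.exp (-quad M ξ)) := by
    have e : |(LinearMap.det f)⁻¹| = (Real.sqrt M.det)⁻¹ := by rw [abs_inv, hdet]
    rw [← e, ← lintegral_comp_linearMap hdf hφ,
      ← lintegral_indicator Metric.isClosed_closedBall.measurableSet]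
    refine lintegral_mono fun v => ?_
    simp only [hφdef]
    by_cases hv : f v ∈ Metric.closedBall (0 : Vec d) (Real.sqrt c / 2)
    · have hv' : v ∈ Metric.closedBall (0 : Vec d) (1 / 2) := by
        rw [mem_closedBall_zero_iff] at *
        have h3 : (Real.sqrt c * ‖v‖) ^ 2 ≤ (Real.sqrt c / 2) ^ 2 := by
          calc (Real.sqrt c * ‖v‖) ^ 2 = c * ‖v‖ ^ 2 := by rw [mul_pow, Real.sq_sqrt hc.le]
            _ ≤ ‖f v‖ ^ 2 := by rw [hf]; exact h v
            _ ≤ _ := pow_le_pow_left₀ (norm_nonneg _) hv 2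
        have h4 := le_of_sq_le_sq h3 (by positivity)
        refine le_of_mul_le_mul_left ?_ hsc
        linarith
      rw [Set.indicator_of_mem hv, Set.indicator_of_mem hv', hf]
    · simp [Set.indicator_of_notMem hv]
  calc _ ≤ ENNReal.ofReal ((2 / Real.sqrt c) ^ d) * ∫⁻ u, φ u := h1
    _ = ENNReal.ofReal (2 ^ d * Real.sqrt M.det / Real.sqrt c ^ d) *
        (ENNReal.ofReal ((Real.sqrt M.det)⁻¹) * ∫⁻ u, φ u) := by
      rw [← mul_assoc, ← ENNReal.ofReal_mul (by positivity)]
      congr 2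
      rw [div_pow]
      field_simp
    _ ≤ _ := by gcongr

/-- Mass of the isotropic Gaussian weight `exp (-c‖ξ‖²)` on the unit ball. -/
def ballMass (d : ℕ) (c : ℝ) : ENNReal :=
  ∫⁻ ξ in Metric.closedBall (0 : Vec d) 1, ENNReal.ofReal (Real.exp (-(c * ‖ξ‖ ^ 2)))

theorem ballMass_ne_zero (c : ℝ) : ballMass d c ≠ 0 := by
  rw [ballMass, ← pos_iff_ne_zero, setLIntegral_pos_iff (by fun_prop)]
  have : Function.support (fun ξ : Vec d => ENNReal.ofReal (Real.exp (-(c * ‖ξ‖ ^ 2)))) =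
      Set.univ := by
    ext ξ
    simp [Real.exp_pos]
  rw [this, Set.univ_inter]
  exact Metric.measure_closedBall_pos _ _ one_pos

theorem ballMass_ne_top {c : ℝ} (hc : 0 ≤ c) : ballMass d c ≠ ⊤ := by
  refine ne_top_of_le_ne_top (b := volume (Metric.closedBall (0 : Vec d) 1))
    (isCompact_closedBall _ _).measure_lt_top.ne ?_
  rw [ballMass, ← setLIntegral_one]
  refine lintegral_mono fun ξ => ?_
  rw [← ENNReal.ofReal_one]
  apply ENNReal.ofReal_le_ofReal
  rw [Real.exp_le_one_iff]
  have : 0 ≤ c * ‖ξ‖ ^ 2 := by positivity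
  linarith

/-- Chain the recentred lower bound on the mixture with the mass comparison; `ballMass d c`, which
has no convenient closed form, is nonzero and finite and cancels. -/
theorem inner_sub_quad_le_of_mixture_le {M : Matrix (Fin d) (Fin d) ℝ} (hM : M.PosDef) {c δ : ℝ}
    (hc : 0 < c) (h : ∀ v : Vec d, c * ‖v‖ ^ 2 ≤ quad M v) (hδ : 0 < δ) {s : Vec d}
    (hmix : ENNReal.ofReal δ * mixture M s ≤ ballMass d c) {ξ₀ : Vec d} (hξ₀ : ‖ξ₀‖ ≤ 1 / 2) :
    inner ℝ ξ₀ s - quad M ξ₀ ≤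
      Real.log (2 ^ d / δ * (Real.sqrt M.det / Real.sqrt c ^ d)) := by
  set E := Real.exp (inner ℝ ξ₀ s - quad M ξ₀) with hE
  set K := 2 ^ d * Real.sqrt M.det / Real.sqrt c ^ d with hK
  have hsc : 0 < Real.sqrt c := Real.sqrt_pos.2 hc
  have hsd : 0 < Real.sqrt M.det := Real.sqrt_pos.2 hM.det_pos
  have hK0 : 0 < K := by positivity
  have hE0 : 0 < E := Real.exp_pos _
  have h1 : ENNReal.ofReal (δ * E) * ballMass d c ≤ ENNReal.ofReal K * ballMass d c := by
    calc ENNReal.ofReal (δ * E) * ballMass d c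
        ≤ ENNReal.ofReal (δ * E) * (ENNReal.ofReal K *
          ∫⁻ ξ in Metric.closedBall (0 : Vec d) (1 / 2),
            ENNReal.ofReal (Real.exp (-quad M ξ))) := by
          gcongr
          exact lintegral_exp_neg_le_mul_lintegral_exp_neg_quad hM hc h
      _ = ENNReal.ofReal K * (ENNReal.ofReal δ * (ENNReal.ofReal E *
          ∫⁻ ξ in Metric.closedBall (0 : Vec d) (1 / 2),
            ENNReal.ofReal (Real.exp (-quad M ξ)))) := by
          rw [ENNReal.ofReal_mul hδ.le]
          ring
      _ ≤ ENNReal.ofReal K * (ENNReal.ofReal δ * mixture M s) := by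
          gcongr
          exact exp_mul_lintegral_le_mixture M s hξ₀
      _ ≤ _ := by gcongr
  have h2 := (ENNReal.mul_le_mul_iff_left (ballMass_ne_zero c) (ballMass_ne_top hc.le)).1 h1
  rw [ENNReal.ofReal_le_ofReal_iff hK0.le] at h2
  rw [Real.le_log_iff_exp_le (by positivity)]
  calc E ≤ K / δ := by rw [le_div_iff₀ hδ]; linarith
    _ = _ := by rw [hK]; ring

/-- On the event where the mixture is small, the score is controlled in the norm dual to `M`. -/
theorem inner_le_of_mixture_le {M : Matrix (Fin d) (Fin d) ℝ} (hM : M.PosDef) {c δ : ℝ}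
    (hc : 0 < c) (h : ∀ v : Vec d, c * ‖v‖ ^ 2 ≤ quad M v) (hδ : 0 < δ) {s : Vec d}
    (hmix : ENNReal.ofReal δ * mixture M s ≤ ballMass d c) (v : Vec d) :
    inner ℝ s v ≤ (Real.sqrt c / 2 + 2 / Real.sqrt c *
      Real.log (2 ^ d / δ * (Real.sqrt M.det / Real.sqrt c ^ d))) * wnorm M v := by
  rcases eq_or_ne v 0 with rfl | hv
  · simp [wnorm]
  set ℓ := Real.log (2 ^ d / δ * (Real.sqrt M.det / Real.sqrt c ^ d))
  have hsc : 0 < Real.sqrt c := Real.sqrt_pos.2 hc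
  have hnv : 0 < ‖v‖ := norm_pos_iff.2 hv
  have hq : 0 < quad M v := (by positivity : 0 < c * ‖v‖ ^ 2).trans_le (h v)
  have hn : 0 < wnorm M v := Real.sqrt_pos.2 hq
  have hsq : wnorm M v ^ 2 = quad M v := Real.sq_sqrt hq.le
  have hle : Real.sqrt c * ‖v‖ ≤ wnorm M v := by
    refine Real.le_sqrt_of_sq_le ?_
    rw [mul_pow, Real.sq_sqrt hc.le]
    exact h v
  -- The multiple of v with M-norm √c/2: its Euclidean norm is at most 1/2 since M ≥ c, and its
  -- quadratic form is c/4. Dividing by the scaling gives the terms √c/2 and 2/√c.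
  have key := inner_sub_quad_le_of_mixture_le hM hc h hδ hmix
    (ξ₀ := (Real.sqrt c / 2 / wnorm M v) • v) (by
      rw [norm_smul, Real.norm_of_nonneg (by positivity), div_div, div_mul_eq_mul_div,
        div_le_div_iff₀ (by positivity) (by norm_num)]
      linarith)
  rw [quad_smul_right, real_inner_smul_left, ← hsq, div_pow, div_pow, Real.sq_sqrt hc.le,
    div_mul_cancel₀ _ (by positivity), real_inner_comm] at key
  change _ ≤ ℓ at key
  have e : Real.sqrt c / 2 / wnorm M v * inner ℝ s v ≤ ℓ + c / 4 := by linarith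
  calc inner ℝ s v
      = (Real.sqrt c / 2 / wnorm M v * inner ℝ s v) * (2 / Real.sqrt c * wnorm M v) := by
        field_simp
    _ ≤ (ℓ + c / 4) * (2 / Real.sqrt c * wnorm M v) := by gcongr
    _ = _ := by
        have hcc : c = Real.sqrt c * Real.sqrt c := (Real.mul_self_sqrt hc.le).symm
        have e2 : c / 4 * (2 / Real.sqrt c) = Real.sqrt c / 2 := by
          rw [div_mul_div_comm, div_eq_div_iff (by positivity) (by norm_num)]
          nlinarith
        calc _ = (c / 4 * (2 / Real.sqrt c) + 2 / Real.sqrt c * ℓ) * wnorm M v := by ring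
          _ = _ := by rw [e2]

end GaussianMixture

/-! ### Ville's inequality and the one-step supermartingale bound. -/

section Supermartingale

variable {Ω : Type*} {m mΩ : MeasurableSpace Ω} {P : Measure Ω}

/-- **Ville's maximal inequality** for nonnegative supermartingales. -/
theorem mul_measure_exists_lt_le {ℱ : ℕ → MeasurableSpace Ω} (hmono : Monotone ℱ)
    (hle : ∀ n, ℱ n ≤ mΩ) {M : ℕ → Ω → ENNReal} (hM : ∀ n, Measurable[ℱ n] (M n))
    (hstep : ∀ n A, MeasurableSet[ℱ n] A → ∫⁻ ω in A, M (n + 1) ω ∂P ≤ ∫⁻ ω in A, M n ω ∂P)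
    (c : ENNReal) : c * P {ω | ∃ n, c < M n ω} ≤ ∫⁻ ω, M 0 ω ∂P := by
  have hMm : ∀ n, Measurable (M n) := fun n => (hM n).mono (hle n) le_rfl
  have hlt : ∀ k n, k ≤ n → MeasurableSet[ℱ n] {ω | c < M k ω} := fun k n hkn =>
    hmono hkn _ (hM k measurableSet_Ioi)
  -- Crossing strictly before time n. Thus `D (n + 1)` is already known at time n, which lets `hstep
  -- n` be applied on its complement.
  set D : ℕ → Set Ω := fun n => ⋃ k ∈ Finset.range n, {ω | c < M k ω} with hD
  have hDmem : ∀ n ω, ω ∈ D n ↔ ∃ k < n, c < M k ω := fun n ω => by simp [hD]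
  have hDmeas : ∀ n m, n ≤ m + 1 → MeasurableSet[ℱ m] (D n) := fun n m hnm =>
    Finset.measurableSet_biUnion _ fun k hk =>
      hlt k m (by have := Finset.mem_range.1 hk; omega)
  have hDm : ∀ n, MeasurableSet (D n) := fun n => hle n _ (hDmeas n n (by omega))
  have hDmono : Monotone D := fun n m hnm ω hω => by
    rw [hDmem] at *
    obtain ⟨k, hk, h⟩ := hω
    exact ⟨k, by omega, h⟩
  have hDsucc : ∀ n, D (n + 1) = D n ∪ ((D n)ᶜ ∩ {ω | c < M n ω}) := fun n => by
    ext ω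
    rw [Set.mem_union, Set.mem_inter_iff, Set.mem_compl_iff, hDmem, hDmem, Set.mem_ofPred_eq]
    constructor
    · rintro ⟨k, hk, h⟩
      by_cases h' : ∃ k < n, c < M k ω
      · exact Or.inl h'
      · refine Or.inr ⟨h', ?_⟩
        rcases Nat.lt_succ_iff_lt_or_eq.1 hk with h1 | rfl
        · exact absurd ⟨k, h1, h⟩ h'
        · exact h
    · rintro (⟨k, hk, h⟩ | ⟨-, h⟩)
      · exact ⟨k, by omega, h⟩
      · exact ⟨n, by omega, h⟩
  -- Optional stopping in disguise: mass c is frozen on paths that have crossed, and the process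
  -- keeps running on the others.
  have key : ∀ n, c * P (D n) + ∫⁻ ω in (D n)ᶜ, M n ω ∂P ≤ ∫⁻ ω, M 0 ω ∂P := by
    intro n
    induction n with
    | zero => simp [hD]
    | succ n ih =>
      refine le_trans ?_ ih
      have hE : MeasurableSet {ω | c < M n ω} := hle n _ (hlt n n le_rfl)
      have hset : (D n)ᶜ \ {ω | c < M n ω} = (D (n + 1))ᶜ := by
        rw [hDsucc]
        ext ω
        simp only [Set.mem_sdiff, Set.mem_compl_iff, Set.mem_union, Set.mem_inter_iff]
        tauto
      have h1 : ∫⁻ ω in (D n)ᶜ, M n ω ∂P =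
          ∫⁻ ω in (D n)ᶜ ∩ {ω | c < M n ω}, M n ω ∂P + ∫⁻ ω in (D (n + 1))ᶜ, M n ω ∂P := by
        rw [← lintegral_inter_add_sdiff _ (D n)ᶜ hE, hset]
      have h2 : c * P ((D n)ᶜ ∩ {ω | c < M n ω}) ≤
          ∫⁻ ω in (D n)ᶜ ∩ {ω | c < M n ω}, M n ω ∂P := by
        rw [← setLIntegral_const]
        exact setLIntegral_mono (hMm n) fun ω hω => hω.2.le
      have h3 : P (D (n + 1)) ≤ P (D n) + P ((D n)ᶜ ∩ {ω | c < M n ω}) := by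
        rw [hDsucc]
        exact measure_union_le _ _
      calc _ ≤ c * (P (D n) + P ((D n)ᶜ ∩ {ω | c < M n ω})) +
            ∫⁻ ω in (D (n + 1))ᶜ, M n ω ∂P := by
            gcongr ?_ + ?_
            · exact mul_le_mul' le_rfl h3
            · exact hstep n _ (hDmeas (n + 1) n le_rfl).compl
        _ ≤ c * P (D n) + (∫⁻ ω in (D n)ᶜ ∩ {ω | c < M n ω}, M n ω ∂P +
            ∫⁻ ω in (D (n + 1))ᶜ, M n ω ∂P) := by
            rw [mul_add, add_assoc]
            gcongr
        _ = _ := by rw [h1]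
  have hU : {ω | ∃ n, c < M n ω} = ⋃ n, D n := by
    ext ω
    simp only [Set.mem_ofPred_eq, Set.mem_iUnion, hDmem]
    exact ⟨fun ⟨n, h⟩ => ⟨n + 1, n, by omega, h⟩, fun ⟨_, k, _, h⟩ => ⟨k, h⟩⟩
  rw [hU, hDmono.measure_iUnion, ENNReal.mul_iSup]
  exact iSup_le fun n => le_self_add.trans (key n)

variable [IsProbabilityMeasure P] {R : Set Ω} {p : Ω → ℝ}

theorem measure_inter_eq_setLIntegral_of_condExp (hm : m ≤ mΩ) (hR : MeasurableSet R)
    (hp : Measurable p) (hp0 : ∀ ω, 0 ≤ p ω) (hp1 : ∀ ω, p ω ≤ 1) (hcond : P⟦R | m⟧ =ᵐ[P] p)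
    {A : Set Ω} (hA : MeasurableSet[m] A) :
    P (A ∩ R) = ∫⁻ ω in A, ENNReal.ofReal (p ω) ∂P := by
  have hint : Integrable p P := by
    refine Integrable.of_bound hp.aestronglyMeasurable 1 (ae_of_all _ fun ω => ?_)
    rw [Real.norm_of_nonneg (hp0 ω)]
    exact hp1 ω
  have h1 : ∫ ω in A, p ω ∂P = P.real (A ∩ R) := by
    rw [← setIntegral_congr_ae (hm A hA) (hcond.mono fun ω h _ => h),
      setIntegral_condExp hm ((integrable_const (1 : ℝ)).indicator hR) hA,
      setIntegral_indicator hR]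
    simp
  rw [← ofReal_integral_eq_lintegral_ofReal hint.integrableOn (ae_of_all _ hp0), h1]
  simp

/-- P restricted to R and P with density p agree on m, so they integrate every m-measurable function
alike. Working in [0, ∞] avoids integrability conditions on the exponential process. -/
theorem setLIntegral_eq_lintegral_mul_of_condExp (hm : m ≤ mΩ) (hR : MeasurableSet R)
    (hp : Measurable p) (hp0 : ∀ ω, 0 ≤ p ω) (hp1 : ∀ ω, p ω ≤ 1) (hcond : P⟦R | m⟧ =ᵐ[P] p)
    {f : Ω → ENNReal} (hf : Measurable[m] f) :
    ∫⁻ ω in R, f ω ∂P = ∫⁻ ω, ENNReal.ofReal (p ω) * f ω ∂P := by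
  have hμ : (P.restrict R).trim hm = (P.withDensity fun ω => ENNReal.ofReal (p ω)).trim hm := by
    refine @Measure.ext _ m _ _ fun A hA => ?_
    rw [trim_measurableSet_eq hm hA, trim_measurableSet_eq hm hA, Measure.restrict_apply (hm A hA),
      withDensity_apply _ (hm A hA),
      measure_inter_eq_setLIntegral_of_condExp hm hR hp hp0 hp1 hcond hA]
  rw [← lintegral_trim hm hf, hμ, lintegral_trim hm hf,
    lintegral_withDensity_eq_lintegral_mul _ (by fun_prop) (hf.mono hm le_rfl)]
  rfl

theorem setLIntegral_compl_eq_lintegral_mul_of_condExp (hm : m ≤ mΩ) (hR : MeasurableSet R)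
    (hp : Measurable p) (hp0 : ∀ ω, 0 ≤ p ω) (hp1 : ∀ ω, p ω ≤ 1) (hcond : P⟦R | m⟧ =ᵐ[P] p)
    {f : Ω → ENNReal} (hf : Measurable[m] f) :
    ∫⁻ ω in Rᶜ, f ω ∂P = ∫⁻ ω, ENNReal.ofReal (1 - p ω) * f ω ∂P := by
  have hμ : (P.restrict Rᶜ).trim hm =
      (P.withDensity fun ω => ENNReal.ofReal (1 - p ω)).trim hm := by
    refine @Measure.ext _ m _ _ fun A hA => ?_
    rw [trim_measurableSet_eq hm hA, trim_measurableSet_eq hm hA, Measure.restrict_apply (hm A hA),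
      withDensity_apply _ (hm A hA)]
    have h1 : P (A ∩ R) + P (A ∩ Rᶜ) = P A := by
      rw [← Set.sdiff_eq]
      exact measure_inter_add_sdiff A hR
    have h2 : ∫⁻ ω in A, ENNReal.ofReal (p ω) ∂P + ∫⁻ ω in A, ENNReal.ofReal (1 - p ω) ∂P =
        P A := by
      rw [← lintegral_add_left (by fun_prop), ← setLIntegral_one]
      refine lintegral_congr fun ω => ?_
      rw [← ENNReal.ofReal_add (hp0 ω) (sub_nonneg.2 (hp1 ω))]
      simp
    rw [← h1, measure_inter_eq_setLIntegral_of_condExp hm hR hp hp0 hp1 hcond hA] at h2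
    -- Cancelling the mass on R is legitimate because it is finite.
    refine ((ENNReal.add_right_inj ?_).1 h2).symm
    rw [← measure_inter_eq_setLIntegral_of_condExp hm hR hp hp0 hp1 hcond hA]
    exact measure_ne_top _ _
  rw [← lintegral_trim hm hf, hμ, lintegral_trim hm hf,
    lintegral_withDensity_eq_lintegral_mul _ (by fun_prop) (hf.mono hm le_rfl)]
  rfl

/-- One step of the exponential supermartingale built from centred Bernoulli variables. -/
theorem setLIntegral_exp_add_bernoulli_le (hm : m ≤ mΩ) {r W η : Ω → ℝ} (hr : Measurable r)
    (hbin : ∀ ω, r ω = 0 ∨ r ω = 1) (hp : Measurable[m] p) (hp0 : ∀ ω, 0 ≤ p ω)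
    (hp1 : ∀ ω, p ω ≤ 1) (hcond : P⟦{ω | r ω = 1} | m⟧ =ᵐ[P] p) (hW : Measurable[m] W)
    (hη : Measurable[m] η) (hη1 : ∀ ω, |η ω| ≤ 1) {A : Set Ω} (hA : MeasurableSet[m] A) :
    ∫⁻ ω in A, ENNReal.ofReal (Real.exp
        (W ω + ((r ω - p ω) * η ω - p ω * (1 - p ω) * η ω ^ 2))) ∂P ≤
      ∫⁻ ω in A, ENNReal.ofReal (Real.exp (W ω)) ∂P := by
  have hR : MeasurableSet {ω | r ω = 1} := hr (measurableSet_singleton 1)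
  have hpm : Measurable p := hp.mono hm le_rfl
  have hFm : ∀ c : ℝ, Measurable[m] (A.indicator fun ω => ENNReal.ofReal (Real.exp
      (W ω + ((c - p ω) * η ω - p ω * (1 - p ω) * η ω ^ 2)))) := fun c => by
    have aux : ∀ {Ω : Type _} [MeasurableSpace Ω] {W p η : Ω → ℝ} {A : Set Ω}, Measurable W →
        Measurable p → Measurable η → MeasurableSet A →
        Measurable (A.indicator fun ω => ENNReal.ofReal (Real.exp
          (W ω + ((c - p ω) * η ω - p ω * (1 - p ω) * η ω ^ 2)))) := by
      intro Ω _ W p η A hW hp hη hA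
      exact Measurable.indicator (by fun_prop) hA
    exact @aux Ω m _ _ _ _ hW hp hη hA
  rw [← lintegral_indicator (hm A hA), ← lintegral_indicator (hm A hA),
    ← lintegral_add_compl _ hR]
  have e1 : ∫⁻ ω in {ω | r ω = 1}, A.indicator (fun ω => ENNReal.ofReal (Real.exp
        (W ω + ((r ω - p ω) * η ω - p ω * (1 - p ω) * η ω ^ 2)))) ω ∂P =
      ∫⁻ ω, ENNReal.ofReal (p ω) * A.indicator (fun ω => ENNReal.ofReal (Real.exp
        (W ω + ((1 - p ω) * η ω - p ω * (1 - p ω) * η ω ^ 2)))) ω ∂P := by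
    rw [← setLIntegral_eq_lintegral_mul_of_condExp hm hR hpm hp0 hp1 hcond (hFm 1)]
    refine setLIntegral_congr_fun hR fun ω hω => ?_
    have hω' : r ω = 1 := hω
    simp only [Set.indicator, hω']
  have e0 : ∫⁻ ω in {ω | r ω = 1}ᶜ, A.indicator (fun ω => ENNReal.ofReal (Real.exp
        (W ω + ((r ω - p ω) * η ω - p ω * (1 - p ω) * η ω ^ 2)))) ω ∂P =
      ∫⁻ ω, ENNReal.ofReal (1 - p ω) * A.indicator (fun ω => ENNReal.ofReal (Real.exp
        (W ω + ((0 - p ω) * η ω - p ω * (1 - p ω) * η ω ^ 2)))) ω ∂P := by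
    rw [← setLIntegral_compl_eq_lintegral_mul_of_condExp hm hR hpm hp0 hp1 hcond (hFm 0)]
    refine setLIntegral_congr_fun hR.compl fun ω hω => ?_
    have hω' : r ω = 0 := (hbin ω).resolve_right hω
    simp only [Set.indicator, hω']
  rw [e1, e0, ← lintegral_add_left]
  · refine lintegral_mono fun ω => ?_
    by_cases hω : ω ∈ A
    · simp only [Set.indicator_of_mem hω]
      rw [← ENNReal.ofReal_mul (hp0 ω), ← ENNReal.ofReal_mul (sub_nonneg.2 (hp1 ω)),
        ← ENNReal.ofReal_add (mul_nonneg (hp0 ω) (Real.exp_pos _).le)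
          (mul_nonneg (sub_nonneg.2 (hp1 ω)) (Real.exp_pos _).le)]
      apply ENNReal.ofReal_le_ofReal
      have h := bernoulli_mgf_le (hp0 ω) (hp1 ω) (hη1 ω)
      set q := p ω
      set a := η ω
      calc q * Real.exp (W ω + ((1 - q) * a - q * (1 - q) * a ^ 2)) +
            (1 - q) * Real.exp (W ω + ((0 - q) * a - q * (1 - q) * a ^ 2))
          = Real.exp (W ω) * Real.exp (-(q * (1 - q) * a ^ 2)) *
            (q * Real.exp (a * (1 - q)) + (1 - q) * Real.exp (-(a * q))) := by
            rw [show W ω + ((1 - q) * a - q * (1 - q) * a ^ 2) =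
                W ω + -(q * (1 - q) * a ^ 2) + a * (1 - q) by ring,
              show W ω + ((0 - q) * a - q * (1 - q) * a ^ 2) =
                W ω + -(q * (1 - q) * a ^ 2) + -(a * q) by ring]
            simp only [Real.exp_add]
            ring
        _ ≤ Real.exp (W ω) * Real.exp (-(q * (1 - q) * a ^ 2)) *
            Real.exp (q * (1 - q) * a ^ 2) := by gcongr
        _ = Real.exp (W ω) := by
            rw [mul_assoc, ← Real.exp_add, neg_add_cancel, Real.exp_zero, mul_one]
    · simp [Set.indicator_of_notMem hω]
  · exact (ENNReal.measurable_ofReal.comp hpm).mul ((hFm 1).mono hm le_rfl)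

end Supermartingale

/-! ### The exponential process of the bandit and its high-probability bound. -/

namespace LogisticBandit

variable {d : ℕ} {Ω : Type*} {m : MeasurableSpace Ω} [mΩ : MeasurableSpace Ω] {P : Measure Ω} (B : LogisticBandit d P)

/-- The centred score `∑_{s < t} (r_{s+1} - μ(x_sᵀ θ_*)) x_s`. -/
def score (t : ℕ) (ω : Ω) : Vec d :=
  ∑ s ∈ Finset.Ico 1 t,
    (B.r (s + 1) ω - Real.sigmoid (inner ℝ (B.x s ω) B.θstar)) • B.x s ω

/-- The contribution of round `s` to the exponent of the exponential process in direction `ξ`. -/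
def increment (s : ℕ) (ω : Ω) (ξ : Vec d) : ℝ :=
  (B.r (s + 1) ω - Real.sigmoid (inner ℝ (B.x s ω) B.θstar)) * inner ℝ (B.x s ω) ξ
    - deriv Real.sigmoid (inner ℝ (B.x s ω) B.θstar) * inner ℝ (B.x s ω) ξ ^ 2

theorem quad_H (lam : ℝ) (t : ℕ) (ω : Ω) (θ v : Vec d) :
    quad (B.H lam t ω θ) v =
      ∑ s ∈ Finset.Ico 1 t, deriv Real.sigmoid (inner ℝ (B.x s ω) θ) * inner ℝ (B.x s ω) v ^ 2
        + lam * ‖v‖ ^ 2 :=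
  quad_sum_smul_outer_add _ _ _ _ _

theorem le_quad_H (lam : ℝ) (t : ℕ) (ω : Ω) (θ v : Vec d) :
    lam * ‖v‖ ^ 2 ≤ quad (B.H lam t ω θ) v :=
  le_quad_sum_smul_outer_add _ (fun _ _ => (deriv_sigmoid_pos _).le) _ _ _

theorem posDef_H {lam : ℝ} (hlam : 0 < lam) (t : ℕ) (ω : Ω) (θ : Vec d) :
    (B.H lam t ω θ).PosDef :=
  posDef_sum_smul_outer_add _ (fun _ _ => (deriv_sigmoid_pos _).le) _ hlam

/-- Writes the exponent as a sum of one-round increments. The regularizer contributes only the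
deterministic -λ‖ξ‖², which acts as the unnormalized Gaussian prior of the mixture. -/
theorem inner_score_sub_quad_H (lam : ℝ) (t : ℕ) (ω : Ω) (ξ : Vec d) :
    inner ℝ ξ (B.score t ω) - quad (B.H lam t ω B.θstar) ξ =
      ∑ s ∈ Finset.Ico 1 t, B.increment s ω ξ - lam * ‖ξ‖ ^ 2 := by
  simp only [quad_H, score, increment, inner_sum, inner_smul_right, Finset.sum_sub_distrib,
    real_inner_comm ξ]
  ring

theorem measurable_increment (s : ℕ) (hx : Measurable[m] (B.x s))
    (hr : Measurable[m] (B.r (s + 1))) :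
    Measurable[m.prod inferInstance] fun q : Ω × Vec d => B.increment s q.1 q.2 := by
  have aux : ∀ {Ω' : Type _} [MeasurableSpace Ω'] (θ : Vec d) (x : Ω' → Vec d) (r : Ω' → ℝ),
      Measurable x → Measurable r → Measurable fun q : Ω' × Vec d =>
        (r q.1 - Real.sigmoid (inner ℝ (x q.1) θ)) * inner ℝ (x q.1) q.2
          - deriv Real.sigmoid (inner ℝ (x q.1) θ) * inner ℝ (x q.1) q.2 ^ 2 := by
    intro Ω' _ θ x r hx hr
    have h1 : Measurable Real.sigmoid := continuous_sigmoid.measurable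
    simp only [deriv_sigmoid_apply]
    fun_prop
  exact @aux Ω m B.θstar (B.x s) (B.r (s + 1)) hx hr

theorem history_mono : Monotone (history B.prior B.x B.r) := fun t u htu => by
  refine sup_le_sup_left ?_ _
  refine biSup_mono fun s hs => ?_
  rw [Finset.mem_Ico] at *
  omega

theorem history_le (t : ℕ) : history B.prior B.x B.r t ≤ mΩ := by
  refine sup_le B.prior_le (iSup₂_le fun s hs => ?_)
  have hs1 := (Finset.mem_Ico.1 hs).1
  exact sup_le (B.measurable_x s hs1).comap_le (B.measurable_r s hs1).comap_le

theorem measurable_x_history {s t : ℕ} (hs : s ∈ Finset.Ico 1 t) :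
    Measurable[history B.prior B.x B.r t] (B.x s) := by
  refine Measurable.mono (comap_measurable (B.x s)) ?_ le_rfl
  exact (le_sup_left.trans (le_iSup₂_of_le s hs le_rfl)).trans le_sup_right

theorem measurable_r_history {s t : ℕ} (hs : s ∈ Finset.Ico 1 t) :
    Measurable[history B.prior B.x B.r t] (B.r (s + 1)) := by
  refine Measurable.mono (comap_measurable (B.r (s + 1))) ?_ le_rfl
  exact (le_sup_right.trans (le_iSup₂_of_le s hs le_rfl)).trans le_sup_right

theorem measurable_expWeight (lam : ℝ) (t : ℕ) :
    Measurable[(history B.prior B.x B.r t).prod inferInstance] fun q : Ω × Vec d =>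
      ENNReal.ofReal (Real.exp
        (inner ℝ q.2 (B.score t q.1) - quad (B.H lam t q.1 B.θstar) q.2)) := by
  simp only [inner_score_sub_quad_H]
  refine ENNReal.measurable_ofReal.comp (Real.measurable_exp.comp ?_)
  refine @Measurable.sub _ _ _ _ _ (_) _ _ ?_ ?_
  · refine @Finset.measurable_fun_sum _ _ _ _ _ _ (_) _ _ fun s hs => ?_
    exact B.measurable_increment s (B.measurable_x_history hs) (B.measurable_r_history hs)
  · exact (by fun_prop : Measurable fun ξ : Vec d => lam * ‖ξ‖ ^ 2).comp measurable_snd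

theorem measurable_mixture (lam : ℝ) (t : ℕ) :
    Measurable[history B.prior B.x B.r t] fun ω =>
      mixture (B.H lam t ω B.θstar) (B.score t ω) :=
  @Measurable.lintegral_prod_right' _ _ (_) _ _ _ _ (B.measurable_expWeight lam t)

theorem abs_inner_x_le (t : ℕ) (ht : 1 ≤ t) (ω : Ω) (v : Vec d) :
    |inner ℝ (B.x t ω) v| ≤ ‖v‖ := by
  have h1 := B.norm_le_one t ht ω _ (B.x_mem t ht ω)
  calc |inner ℝ (B.x t ω) v| ≤ ‖B.x t ω‖ * ‖v‖ := abs_real_inner_le_norm _ _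
    _ ≤ 1 * ‖v‖ := by gcongr
    _ = _ := one_mul _

/-- The Bernoulli step with p = μ(x_tᵀθ_*) and η = x_tᵀξ. It is applied over the history enlarged by
x_t, where p and η are measurable, and then read on events of the history alone. -/
theorem setLIntegral_expWeight_succ_le [IsProbabilityMeasure P] (lam : ℝ) {t : ℕ} (ht : 1 ≤ t)
    {A : Set Ω} (hA : MeasurableSet[history B.prior B.x B.r t] A) {ξ : Vec d} (hξ : ‖ξ‖ ≤ 1) :
    ∫⁻ ω in A, ENNReal.ofReal (Real.exp
        (inner ℝ ξ (B.score (t + 1) ω) - quad (B.H lam (t + 1) ω B.θstar) ξ)) ∂P ≤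
      ∫⁻ ω in A, ENNReal.ofReal (Real.exp
        (inner ℝ ξ (B.score t ω) - quad (B.H lam t ω B.θstar) ξ)) ∂P := by
  have hxm : Measurable[history B.prior B.x B.r t ⊔ MeasurableSpace.comap (B.x t) inferInstance]
      (B.x t) := (comap_measurable (B.x t)).mono le_sup_right le_rfl
  have hW : Measurable[history B.prior B.x B.r t ⊔ MeasurableSpace.comap (B.x t) inferInstance]
      fun ω => inner ℝ ξ (B.score t ω) - quad (B.H lam t ω B.θstar) ξ := by
    simp only [inner_score_sub_quad_H]
    refine Measurable.mono ?_ le_sup_left le_rfl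
    refine @Measurable.sub_const _ _ _ _ _ (_) _ ?_ _
    refine @Finset.measurable_fun_sum _ _ _ _ _ _ (_) _ _ fun s hs => ?_
    exact (B.measurable_increment s (B.measurable_x_history hs)
      (B.measurable_r_history hs)).comp measurable_prodMk_right
  have key := setLIntegral_exp_add_bernoulli_le (P := P)
    (sup_le (B.history_le t) (B.measurable_x t ht).comap_le) (B.measurable_r t ht)
    (B.r_binary t ht)
    (continuous_sigmoid.measurable.comp
      ((by fun_prop : Measurable fun a : Vec d => (inner ℝ a B.θstar : ℝ)).comp hxm))
    (fun ω => Real.sigmoid_nonneg _) (fun ω => Real.sigmoid_le_one _) (B.reward_model t ht) hW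
    ((by fun_prop : Measurable fun a : Vec d => (inner ℝ a ξ : ℝ)).comp hxm)
    (fun ω => (B.abs_inner_x_le t ht ω ξ).trans hξ)
    (le_sup_left (b := MeasurableSpace.comap (B.x t) inferInstance) A hA)
  refine le_trans (le_of_eq (lintegral_congr fun ω => ?_)) key
  rw [inner_score_sub_quad_H, inner_score_sub_quad_H, Finset.sum_Ico_succ_top ht, increment,
    deriv_sigmoid_apply]
  simp only [Function.comp_apply]
  congr 2
  ring

theorem setLIntegral_mixture_succ_le [IsProbabilityMeasure P] (lam : ℝ) (t : ℕ)
    {A : Set Ω} (hA : MeasurableSet[history B.prior B.x B.r t] A) :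
    ∫⁻ ω in A, mixture (B.H lam (t + 1) ω B.θstar) (B.score (t + 1) ω) ∂P ≤
      ∫⁻ ω in A, mixture (B.H lam t ω B.θstar) (B.score t ω) ∂P := by
  -- Rounds start at 1, so times 0 and 1 both have an empty sum and the same mixture.
  rcases Nat.eq_zero_or_pos t with rfl | ht
  · simp [H, score]
  have hm : ∀ u, Measurable fun q : Ω × Vec d => ENNReal.ofReal (Real.exp
      (inner ℝ q.2 (B.score u q.1) - quad (B.H lam u q.1 B.θstar) q.2)) := fun u =>
    (B.measurable_expWeight lam u).mono
      (sup_le_sup_right (MeasurableSpace.comap_mono (B.history_le u)) _) le_rfl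
  -- Tonelli reduces the mixture to the supermartingale property at each fixed ξ.
  have hswap : ∀ u, ∫⁻ ω in A, mixture (B.H lam u ω B.θstar) (B.score u ω) ∂P =
      ∫⁻ ξ in Metric.closedBall (0 : Vec d) 1, ∫⁻ ω in A, ENNReal.ofReal (Real.exp
        (inner ℝ ξ (B.score u ω) - quad (B.H lam u ω B.θstar) ξ)) ∂P := fun u =>
    lintegral_lintegral_swap (hm u).aemeasurable
  rw [hswap, hswap]
  refine setLIntegral_mono' Metric.isClosed_closedBall.measurableSet fun ξ hξ => ?_
  exact B.setLIntegral_expWeight_succ_le lam ht hA (mem_closedBall_zero_iff.1 hξ)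

theorem mixture_zero (lam : ℝ) (ω : Ω) :
    mixture (B.H lam 0 ω B.θstar) (B.score 0 ω) = ballMass d lam := by
  simp only [mixture, inner_score_sub_quad_H, ballMass]
  simp

/-- With probability at least `1 - δ` the mixture never exceeds `1 / δ` times its initial value. -/
theorem holdsWithProb_mixture_le [IsProbabilityMeasure P] {lam δ : ℝ} (hlam : 0 < lam)
    (hδ : 0 < δ) :
    HoldsWithProb P (1 - δ) fun ω => ∀ t,
      ENNReal.ofReal δ * mixture (B.H lam t ω B.θstar) (B.score t ω) ≤ ballMass d lam := by
  have hb0 := ballMass_ne_zero (d := d) lam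
  have hbt := ballMass_ne_top (d := d) hlam.le
  have hδ0 : ENNReal.ofReal δ ≠ 0 := by simpa using hδ
  have hδt : ENNReal.ofReal δ ≠ ⊤ := ENNReal.ofReal_ne_top
  set c := ballMass d lam / ENNReal.ofReal δ with hc
  set F : Set Ω := {ω | ∃ t, c < mixture (B.H lam t ω B.θstar) (B.score t ω)} with hF
  have hFm : MeasurableSet F := by
    have : F = ⋃ t, {ω | c < mixture (B.H lam t ω B.θstar) (B.score t ω)} := by
      ext ω; simp [hF]
    rw [this]
    exact MeasurableSet.iUnion fun t =>
      ((B.measurable_mixture lam t).mono (B.history_le t) le_rfl) measurableSet_Ioi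
  have hville : c * P F ≤ ballMass d lam := by
    have := mul_measure_exists_lt_le (P := P) B.history_mono B.history_le
      (B.measurable_mixture lam) (fun t A hA => B.setLIntegral_mixture_succ_le lam t hA) c
    simpa only [mixture_zero, lintegral_const, measure_univ, mul_one] using this
  have hPF : P F ≤ ENNReal.ofReal δ := by
    have hc0 : c ≠ 0 := ENNReal.div_ne_zero.2 ⟨hb0, hδt⟩
    have hct : c ≠ ⊤ := ENNReal.div_ne_top hbt hδ0
    have e : ballMass d lam = c * ENNReal.ofReal δ := by
      rw [hc, ENNReal.div_mul_cancel hδ0 hδt]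
    rw [e] at hville
    exact (ENNReal.mul_le_mul_iff_right hc0 hct).1 hville
  refine ⟨Fᶜ, hFm.compl, ?_, fun ω hω t => ?_⟩
  · rw [prob_compl_eq_one_sub hFm, ENNReal.ofReal_sub _ hδ.le, ENNReal.ofReal_one]
    exact tsub_le_tsub_left hPF _
  · have h1 : mixture (B.H lam t ω B.θstar) (B.score t ω) ≤ c := by
      by_contra! h
      exact hω ⟨t, h⟩
    calc _ ≤ ENNReal.ofReal δ * c := by gcongr
      _ = _ := by rw [mul_comm, hc, ENNReal.div_mul_cancel hδ0 hδt]

end LogisticBandit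

/-! ### Constants S and κ, the likelihood equation and the confidence inequality. -/

namespace LogisticBandit

variable {d : ℕ} {Ω : Type*} [mΩ : MeasurableSpace Ω] {P : Measure Ω} (B : LogisticBandit d P)

theorem norm_le_S {θ : Vec d} (hθ : θ ∈ B.Θ) : ‖θ‖ ≤ B.S :=
  le_csSup (B.isCompact_Θ.bddAbove_image continuous_norm.continuousOn)
    (Set.mem_image_of_mem _ hθ)

theorem S_nonneg : 0 ≤ B.S := (norm_nonneg _).trans (B.norm_le_S B.θstar_mem)

/-- All the inner products lie in the compact interval [-S, S], on which 1/μ' is continuous. Without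
boundedness the real supremum κ would be a junk value. -/
theorem bddAbove_inv_deriv_sigmoid :
    BddAbove {k : ℝ | ∃ a ∈ B.allArms, ∃ θ ∈ B.Θ, k = 1 / deriv Real.sigmoid (inner ℝ a θ)} := by
  have hcont : Continuous fun z : ℝ => 1 / deriv Real.sigmoid z := by
    refine continuous_const.div ?_ fun z => (deriv_sigmoid_pos z).ne'
    rw [Real.deriv_sigmoid]
    exact continuous_sigmoid.mul (continuous_const.sub continuous_sigmoid)
  refine ((isCompact_Icc (a := -B.S) (b := B.S)).bddAbove_image hcont.continuousOn).mono ?_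
  rintro k ⟨a, ⟨t, ht, ω, ha⟩, θ, hθ, rfl⟩
  refine ⟨inner ℝ a θ, abs_le.1 ?_, rfl⟩
  calc |inner ℝ a θ| ≤ ‖a‖ * ‖θ‖ := abs_real_inner_le_norm _ _
    _ ≤ 1 * B.S := by
      gcongr
      · exact B.norm_le_one t ht ω a ha
      · exact B.norm_le_S hθ
    _ = _ := one_mul _

theorem one_div_deriv_sigmoid_le_kappa {t : ℕ} (ht : 1 ≤ t) {ω : Ω} {a θ : Vec d}
    (ha : a ∈ B.arms t ω) (hθ : θ ∈ B.Θ) :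
    1 / deriv Real.sigmoid (inner ℝ a θ) ≤ B.kappa :=
  le_csSup B.bddAbove_inv_deriv_sigmoid ⟨a, ⟨t, ht, ω, ha⟩, θ, hθ, rfl⟩

theorem four_le_kappa [Nonempty Ω] : 4 ≤ B.kappa := by
  obtain ⟨ω⟩ := ‹Nonempty Ω›
  refine le_trans ?_ (B.one_div_deriv_sigmoid_le_kappa le_rfl (B.x_mem 1 le_rfl ω) B.θstar_mem)
  rw [le_div_iff₀ (deriv_sigmoid_pos _)]
  linarith [deriv_sigmoid_le (inner ℝ (B.x 1 ω) B.θstar)]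

theorem inv_kappa_le_deriv_sigmoid {t : ℕ} (ht : 1 ≤ t) {ω : Ω} {a θ : Vec d}
    (ha : a ∈ B.arms t ω) (hθ : θ ∈ B.Θ) :
    B.kappa⁻¹ ≤ deriv Real.sigmoid (inner ℝ a θ) := by
  have h := B.one_div_deriv_sigmoid_le_kappa ht ha hθ
  rw [one_div] at h
  exact inv_le_of_inv_le₀ (deriv_sigmoid_pos _) h

/-- The first-order optimality condition for the maximum likelihood estimator. -/
theorem g_eq_of_isMaxOn_logLik {lam : ℝ} {t : ℕ} {ω : Ω} {θ : Vec d}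
    (h : IsMaxOn (B.logLik lam t ω) Set.univ θ) :
    B.g lam t ω θ = ∑ s ∈ Finset.Ico 1 t, B.r (s + 1) ω • B.x s ω := by
  refine ext_inner_right ℝ fun v => ?_
  have hline : ∀ a : Vec d, HasDerivAt (fun ε : ℝ => (inner ℝ a (θ + ε • v) : ℝ))
      (inner ℝ a v) 0 := fun a => by
    have : (fun ε : ℝ => (inner ℝ a (θ + ε • v) : ℝ)) =
        fun ε => inner ℝ a θ + ε * inner ℝ a v := by
      ext ε; rw [inner_add_right, inner_smul_right]
    rw [this]
    simpa using ((hasDerivAt_id (0 : ℝ)).mul_const (inner ℝ a v)).const_add (inner ℝ a θ)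
  have hnorm : HasDerivAt (fun ε : ℝ => ‖θ + ε • v‖ ^ 2) (2 * inner ℝ θ v) 0 := by
    have : (fun ε : ℝ => ‖θ + ε • v‖ ^ 2) =
        fun ε => ‖θ‖ ^ 2 + (2 * inner ℝ θ v) * ε + ‖v‖ ^ 2 * ε ^ 2 := by
      ext ε
      rw [norm_add_sq_real, inner_smul_right, norm_smul, mul_pow, Real.norm_eq_abs, sq_abs]
      ring
    rw [this]
    have h1 := ((hasDerivAt_id (0 : ℝ)).const_mul (2 * inner ℝ θ v)).const_add (‖θ‖ ^ 2)
    have h2 := ((hasDerivAt_id (0 : ℝ)).pow 2).const_mul (‖v‖ ^ 2)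
    simpa using h1.fun_add h2
  have hterm : ∀ s, HasDerivAt (fun ε : ℝ =>
      B.r (s + 1) ω * Real.log (Real.sigmoid (inner ℝ (B.x s ω) (θ + ε • v)))
      + (1 - B.r (s + 1) ω) * Real.log (1 - Real.sigmoid (inner ℝ (B.x s ω) (θ + ε • v))))
      ((B.r (s + 1) ω - Real.sigmoid (inner ℝ (B.x s ω) θ)) * inner ℝ (B.x s ω) v) 0 := fun s => by
    have hp := Real.sigmoid_pos (inner ℝ (B.x s ω) θ)
    have hq : 0 < 1 - Real.sigmoid (inner ℝ (B.x s ω) θ) := sub_pos.2 (Real.sigmoid_lt_one _)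
    have hsig : HasDerivAt (fun ε : ℝ => Real.sigmoid (inner ℝ (B.x s ω) (θ + ε • v)))
        (Real.sigmoid (inner ℝ (B.x s ω) θ) * (1 - Real.sigmoid (inner ℝ (B.x s ω) θ)) *
          inner ℝ (B.x s ω) v) 0 := by
      have h0 := Real.hasDerivAt_sigmoid (inner ℝ (B.x s ω) (θ + (0 : ℝ) • v))
      have := h0.comp (0 : ℝ) (hline (B.x s ω))
      simpa [Function.comp_def] using this
    have h1 := (hsig.log (by simpa using hp.ne')).const_mul (B.r (s + 1) ω)
    have h2 := ((hsig.const_sub 1).log (by simpa using hq.ne')).const_mul (1 - B.r (s + 1) ω)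
    refine (h1.fun_add h2).congr_deriv ?_
    simp only [zero_smul, add_zero]
    field_simp
    ring
  have hder : HasDerivAt (fun ε : ℝ => B.logLik lam t ω (θ + ε • v))
      (∑ s ∈ Finset.Ico 1 t,
        (B.r (s + 1) ω - Real.sigmoid (inner ℝ (B.x s ω) θ)) * inner ℝ (B.x s ω) v
        - lam / 2 * (2 * inner ℝ θ v)) 0 :=
    (HasDerivAt.fun_sum fun s _ => hterm s).sub (hnorm.const_mul (lam / 2))
  have hmax : IsLocalMax (fun ε : ℝ => B.logLik lam t ω (θ + ε • v)) 0 :=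
    Filter.Eventually.of_forall fun ε => by simpa using h (Set.mem_univ (θ + ε • v))
  have hzero := hmax.hasDerivAt_eq_zero hder
  simp only [sub_mul, Finset.sum_sub_distrib] at hzero
  simp only [g, inner_add_left, sum_inner, real_inner_smul_left]
  linarith

theorem one_le_gam_arg {lam δ : ℝ} (hlam : 0 < lam) (hδ : 0 < δ) (hδ1 : δ ≤ 1) (t : ℕ) :
    1 ≤ (2 : ℝ) ^ d / δ * (1 + sigmoidL * t / (d * lam)) ^ ((d : ℝ) / 2) := by
  have h1 : (1 : ℝ) ≤ 2 ^ d / δ := by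
    rw [le_div_iff₀ hδ, one_mul]
    exact hδ1.trans (one_le_pow₀ (by norm_num))
  have h2 : (1 : ℝ) ≤ (1 + sigmoidL * t / (d * lam)) ^ ((d : ℝ) / 2) := by
    apply Real.one_le_rpow _ (by positivity)
    have : 0 ≤ sigmoidL * t / (d * lam) := by unfold sigmoidL; positivity
    linarith
  exact one_le_mul_of_one_le_of_one_le h1 h2

theorem gam_nonneg {lam δ : ℝ} (hlam : 0 < lam) (hδ : 0 < δ) (hδ1 : δ ≤ 1) (t : ℕ) :
    0 ≤ B.gam lam δ t := by
  have h1 := Real.log_nonneg (one_le_gam_arg (d := d) hlam hδ hδ1 t)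
  have h2 := B.S_nonneg
  unfold gam
  positivity

theorem gam_mono {lam δ : ℝ} (hlam : 0 < lam) (hδ : 0 < δ) (hδ1 : δ ≤ 1) {t T : ℕ}
    (htT : t ≤ T) : B.gam lam δ t ≤ B.gam lam δ T := by
  have h1 := one_le_gam_arg (d := d) hlam hδ hδ1 t
  unfold gam
  gcongr
  · unfold sigmoidL; positivity
  · unfold sigmoidL; norm_num

/-- The trace of H is at most Lt + λd, since μ' ≤ L and arms have norm at most 1; the
arithmetic-geometric mean inequality converts this into a determinant bound. -/
theorem sqrt_det_H_div_le (hd : 1 ≤ d) {lam : ℝ} (hlam : 0 < lam) (t : ℕ) (ω : Ω) (θ : Vec d) :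
    Real.sqrt (B.H lam t ω θ).det / Real.sqrt lam ^ d ≤
      (1 + sigmoidL * t / (d * lam)) ^ ((d : ℝ) / 2) := by
  have hd0 : (0 : ℝ) < d := by positivity
  have hPD := B.posDef_H hlam t ω θ
  have htr : (B.H lam t ω θ).trace ≤ sigmoidL * t + lam * d := by
    rw [H, trace_sum_smul_outer_add]
    gcongr
    calc ∑ s ∈ Finset.Ico 1 t, deriv Real.sigmoid (inner ℝ (B.x s ω) θ) * ‖B.x s ω‖ ^ 2
        ≤ ∑ s ∈ Finset.Ico 1 t, sigmoidL := by
          refine Finset.sum_le_sum fun s hs => ?_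
          have hs1 := (Finset.mem_Ico.1 hs).1
          have hn := B.norm_le_one s hs1 ω _ (B.x_mem s hs1 ω)
          have h1 := deriv_sigmoid_le (inner ℝ (B.x s ω) θ)
          have h2 : ‖B.x s ω‖ ^ 2 ≤ 1 := pow_le_one₀ (norm_nonneg _) hn
          calc _ ≤ 1 / 4 * (1 : ℝ) := by gcongr
            _ = sigmoidL := by rw [sigmoidL, mul_one]
      _ ≤ sigmoidL * t := by
          rw [Finset.sum_const, Nat.card_Ico, nsmul_eq_mul, mul_comm]
          have : ((t - 1 : ℕ) : ℝ) ≤ t := by exact_mod_cast Nat.sub_le t 1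
          unfold sigmoidL
          gcongr
  set y := 1 + sigmoidL * t / (d * lam) with hy
  have hy0 : 0 < y := by rw [hy]; unfold sigmoidL; positivity
  have htr0 : 0 ≤ (B.H lam t ω θ).trace := hPD.posSemidef.trace_nonneg
  have hdet : (B.H lam t ω θ).det ≤ (lam * y) ^ d := by
    refine (hPD.det_le_trace_div_pow hd).trans ?_
    gcongr
    rw [div_le_iff₀ hd0]
    refine htr.trans (le_of_eq ?_)
    rw [hy]
    field_simp
    ring
  have hrp : y ^ ((d : ℝ) / 2) = Real.sqrt y ^ d := by
    rw [Real.sqrt_eq_rpow, ← Real.rpow_natCast, ← Real.rpow_mul hy0.le]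
    congr 1
    ring
  have hsq : Real.sqrt ((lam * y) ^ d) = Real.sqrt lam ^ d * Real.sqrt y ^ d := by
    rw [← mul_pow, ← Real.sqrt_mul hlam.le]
    rw [← Real.sqrt_sq (x := Real.sqrt (lam * y) ^ d) (by positivity), ← pow_mul, mul_comm d 2,
      pow_mul, Real.sq_sqrt (by positivity)]
  have hsl : 0 < Real.sqrt lam := Real.sqrt_pos.2 hlam
  rw [hrp, div_le_iff₀ (by positivity), mul_comm, ← hsq]
  exact Real.sqrt_le_sqrt hdet

/-- The confidence-set inequality on the event where the mixture is controlled. -/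
theorem wnorm_g_sub_le_gam (hd : 1 ≤ d) {lam δ : ℝ} (hlam : 0 < lam) (hδ : 0 < δ) (hδ1 : δ ≤ 1)
    {t : ℕ} {ω : Ω} (hmix : ENNReal.ofReal δ * mixture (B.H lam t ω B.θstar) (B.score t ω) ≤
      ballMass d lam) {θhat : Vec d} (hmax : IsMaxOn (B.logLik lam t ω) Set.univ θhat) :
    wnorm (B.H lam t ω B.θstar)⁻¹ (B.g lam t ω B.θstar - B.g lam t ω θhat) ≤ B.gam lam δ t := by
  have hPD := B.posDef_H hlam t ω B.θstar
  have hsl : 0 < Real.sqrt lam := Real.sqrt_pos.2 hlam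
  refine wnorm_inv_le_of_inner_le hPD (B.gam_nonneg hlam hδ hδ1 t) fun v => ?_
  have hw : B.g lam t ω B.θstar - B.g lam t ω θhat = lam • B.θstar - B.score t ω := by
    rw [B.g_eq_of_isMaxOn_logLik hmax, g, score]
    simp only [sub_smul, Finset.sum_sub_distrib]
    abel
  -- The score enters `hw` with a minus sign, hence the test vector -v. It contributes √λ/2 and the
  -- logarithm of γ; the term λθ_* contributes √λ S.
  have h1 := inner_le_of_mixture_le hPD hlam (B.le_quad_H lam t ω B.θstar) hδ hmix (-v)
  have hneg : wnorm (B.H lam t ω B.θstar) (-v) = wnorm (B.H lam t ω B.θstar) v := by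
    rw [wnorm_eq_sqrt_quad, quad_neg, wnorm_eq_sqrt_quad]
  rw [inner_neg_right, hneg] at h1
  have hv : Real.sqrt lam * ‖v‖ ≤ wnorm (B.H lam t ω B.θstar) v := by
    refine Real.le_sqrt_of_sq_le ?_
    rw [mul_pow, Real.sq_sqrt hlam.le]
    exact B.le_quad_H lam t ω B.θstar v
  have h2 : lam * inner ℝ B.θstar v ≤
      Real.sqrt lam * B.S * wnorm (B.H lam t ω B.θstar) v := by
    calc lam * inner ℝ B.θstar v ≤ lam * (B.S * ‖v‖) := by
          gcongr
          refine (real_inner_le_norm _ _).trans ?_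
          gcongr
          exact B.norm_le_S B.θstar_mem
      _ = Real.sqrt lam * B.S * (Real.sqrt lam * ‖v‖) := by
          nth_rewrite 1 [← Real.mul_self_sqrt hlam.le]
          ring
      _ ≤ _ := by
          have := B.S_nonneg
          gcongr
  have hsd : 0 < Real.sqrt (B.H lam t ω B.θstar).det := Real.sqrt_pos.2 hPD.det_pos
  have h3 : Real.log (2 ^ d / δ *
      (Real.sqrt (B.H lam t ω B.θstar).det / Real.sqrt lam ^ d)) ≤
      Real.log ((2 : ℝ) ^ d / δ * (1 + sigmoidL * t / (d * lam)) ^ ((d : ℝ) / 2)) := by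
    apply Real.log_le_log (by positivity)
    gcongr
    exact B.sqrt_det_H_div_le hd hlam t ω B.θstar
  have h4 := wnorm_nonneg (B.H lam t ω B.θstar) v
  rw [hw, inner_sub_left, real_inner_smul_left, gam]
  set W := wnorm (B.H lam t ω B.θstar) v
  calc lam * inner ℝ B.θstar v - inner ℝ (B.score t ω) v
      ≤ Real.sqrt lam * B.S * W + (Real.sqrt lam / 2 + 2 / Real.sqrt lam *
        Real.log (2 ^ d / δ * (Real.sqrt (B.H lam t ω B.θstar).det / Real.sqrt lam ^ d))) * W := by
        linarith
    _ ≤ Real.sqrt lam * B.S * W + (Real.sqrt lam / 2 + 2 / Real.sqrt lam *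
        Real.log ((2 : ℝ) ^ d / δ * (1 + sigmoidL * t / (d * lam)) ^ ((d : ℝ) / 2))) * W := by
        gcongr
    _ = _ := by ring

/-! ### Estimation error of the projected estimator. -/

theorem V_eq (lam : ℝ) (t : ℕ) (ω : Ω) : B.V lam t ω =
    ∑ s ∈ Finset.Ico 1 t, (1 : ℝ) • outer (B.x s ω) +
      (B.kappa * lam) • (1 : Matrix (Fin d) (Fin d) ℝ) := by
  simp [V]

theorem posDef_V [Nonempty Ω] {lam : ℝ} (hlam : 0 < lam) (t : ℕ) (ω : Ω) :
    (B.V lam t ω).PosDef := by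
  have := B.four_le_kappa
  rw [V_eq]
  exact posDef_sum_smul_outer_add _ (fun _ _ => zero_le_one) _ (by positivity)

theorem le_quad_V (lam : ℝ) (t : ℕ) (ω : Ω) (v : Vec d) :
    B.kappa * lam * ‖v‖ ^ 2 ≤ quad (B.V lam t ω) v := by
  rw [V_eq]
  exact le_quad_sum_smul_outer_add _ (fun _ _ => zero_le_one) _ _ _

theorem inner_g_sub_g (lam : ℝ) (t : ℕ) (ω : Ω) (θ θ' : Vec d) :
    inner ℝ (B.g lam t ω θ - B.g lam t ω θ') (θ - θ') =
      ∑ s ∈ Finset.Ico 1 t,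
        (Real.sigmoid (inner ℝ (B.x s ω) θ) - Real.sigmoid (inner ℝ (B.x s ω) θ')) *
          (inner ℝ (B.x s ω) θ - inner ℝ (B.x s ω) θ') + lam * ‖θ - θ'‖ ^ 2 := by
  have e : B.g lam t ω θ - B.g lam t ω θ' =
      ∑ s ∈ Finset.Ico 1 t,
        (Real.sigmoid (inner ℝ (B.x s ω) θ) - Real.sigmoid (inner ℝ (B.x s ω) θ')) • B.x s ω
        + lam • (θ - θ') := by
    simp only [g, sub_smul, Finset.sum_sub_distrib, smul_sub]
    abel
  rw [e, inner_add_left, sum_inner, real_inner_smul_left, real_inner_self_eq_norm_sq]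
  simp only [real_inner_smul_left, inner_sub_right, mul_sub]

/-- Self-concordance round by round; |x_sᵀ(θ - θ')| ≤ 2S gives the factor 1 + 2S. The matrix is
taken at the first parameter, and the right side is symmetric, so the bound is available at either
end. -/
theorem quad_H_le_inner_g_sub_g {lam : ℝ} (hlam : 0 < lam) (t : ℕ) (ω : Ω) {θ θ' : Vec d}
    (hθ : θ ∈ B.Θ) (hθ' : θ' ∈ B.Θ) :
    quad (B.H lam t ω θ) (θ - θ') ≤
      (1 + 2 * B.S) * inner ℝ (B.g lam t ω θ - B.g lam t ω θ') (θ - θ') := by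
  rw [quad_H, inner_g_sub_g, mul_add, Finset.mul_sum]
  refine add_le_add (Finset.sum_le_sum fun s hs => ?_) ?_
  · have h1 := B.abs_inner_x_le s (Finset.mem_Ico.1 hs).1 ω (θ' - θ)
    have h2 := norm_sub_le θ' θ
    have h3 := B.norm_le_S hθ
    have h4 := B.norm_le_S hθ'
    have key := deriv_sigmoid_mul_sq_le (a := inner ℝ (B.x s ω) θ) (b := inner ℝ (B.x s ω) θ')
      (D := 2 * B.S) (by rw [← inner_sub_right]; linarith)
    rw [inner_sub_right]
    linear_combination key
  · have h1 : 0 ≤ lam * ‖θ - θ'‖ ^ 2 := by positivity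
    nlinarith [B.S_nonneg]

/-- Both ends lie in Θ, where μ' ≥ 1/κ at the arms played. Unimodality of μ' extends this to the
segment, so convexity of Θ is not required. -/
theorem quad_V_le_inner_g_sub_g [Nonempty Ω] (lam : ℝ) (t : ℕ) (ω : Ω)
    {θ θ' : Vec d} (hθ : θ ∈ B.Θ) (hθ' : θ' ∈ B.Θ) :
    quad (B.V lam t ω) (θ - θ') ≤
      B.kappa * inner ℝ (B.g lam t ω θ - B.g lam t ω θ') (θ - θ') := by
  have hκ := B.four_le_kappa
  have hκ0 : 0 < B.kappa := by linarith
  rw [V_eq, quad_sum_smul_outer_add, inner_g_sub_g, mul_add, Finset.mul_sum, mul_assoc]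
  refine add_le_add (Finset.sum_le_sum fun s hs => ?_) le_rfl
  have hs1 := (Finset.mem_Ico.1 hs).1
  have key := mul_sq_le_sigmoid_sub_mul
    (B.inv_kappa_le_deriv_sigmoid hs1 (B.x_mem s hs1 ω) hθ')
    (B.inv_kappa_le_deriv_sigmoid hs1 (B.x_mem s hs1 ω) hθ)
  calc 1 * inner ℝ (B.x s ω) (θ - θ') ^ 2
      = B.kappa * (B.kappa⁻¹ * (inner ℝ (B.x s ω) θ - inner ℝ (B.x s ω) θ') ^ 2) := by
        rw [inner_sub_right]; field_simp
    _ ≤ _ := by gcongr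

/-- The error of the projected estimator in the direction of an arm. -/
theorem abs_inner_sub_le [Nonempty Ω] {lam : ℝ} (hlam : 0 < lam) {t : ℕ} {ω : Ω} {γ : ℝ}
    {θhat θ : Vec d} (hθ : θ ∈ B.Θ)
    (hmin : IsMinOn (B.projLoss lam t ω θhat) B.Θ θ)
    (hγ : wnorm (B.H lam t ω B.θstar)⁻¹ (B.g lam t ω B.θstar - B.g lam t ω θhat) ≤ γ)
    (a : Vec d) :
    |inner ℝ a (B.θstar - θ)| ≤
      Real.sqrt (4 + 8 * B.S) * Real.sqrt B.kappa * γ * wnorm (B.V lam t ω)⁻¹ a := by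
  have hγ0 : 0 ≤ γ := (wnorm_nonneg _ _).trans hγ
  have hS := B.S_nonneg
  have hκ := B.four_le_kappa
  have hγ' : wnorm (B.H lam t ω θ)⁻¹ (B.g lam t ω θ - B.g lam t ω θhat) ≤ γ :=
    le_trans (hmin B.θstar_mem) hγ
  set v := B.θstar - θ with hv
  set D := inner ℝ (B.g lam t ω B.θstar - B.g lam t ω θ) v with hD
  have hH := B.quad_H_le_inner_g_sub_g hlam t ω B.θstar_mem hθ
  have hH' := B.quad_H_le_inner_g_sub_g hlam t ω hθ B.θstar_mem
  have hsymm : inner ℝ (B.g lam t ω θ - B.g lam t ω B.θstar) (θ - B.θstar) = D := by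
    rw [← neg_sub B.θstar θ, ← neg_sub (B.g lam t ω B.θstar), inner_neg_neg]
  rw [hsymm, ← neg_sub B.θstar θ, quad_neg] at hH'
  change quad _ v ≤ (1 + 2 * B.S) * D at hH hH'
  have hV : quad (B.V lam t ω) v ≤ B.kappa * D := B.quad_V_le_inner_g_sub_g lam t ω B.θstar_mem hθ
  have hD0 : 0 ≤ D := by
    have := ((B.posDef_V hlam t ω).quad_nonneg v).trans hV
    exact nonneg_of_mul_nonneg_right this (by linarith)
  set q := Real.sqrt ((1 + 2 * B.S) * D) with hq
  have hq0 : 0 ≤ q := Real.sqrt_nonneg _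
  -- Split at θ̂ and pair each half with its own matrix, H(θ_*) or H(θ). The second dual norm is at
  -- most γ because θ minimizes the projection loss and θ_* is a competitor.
  have hDle : D ≤ 2 * γ * q := by
    have e : D = inner ℝ (B.g lam t ω B.θstar - B.g lam t ω θhat) v +
        inner ℝ (B.g lam t ω θ - B.g lam t ω θhat) (-v) := by
      rw [inner_neg_right, ← sub_eq_add_neg, ← inner_sub_left, sub_sub_sub_cancel_right]
    have h1 := inner_le_wnorm_inv_mul_wnorm (B.posDef_H hlam t ω B.θstar)
      (B.g lam t ω B.θstar - B.g lam t ω θhat) v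
    have h2 := inner_le_wnorm_inv_mul_wnorm (B.posDef_H hlam t ω θ)
      (B.g lam t ω θ - B.g lam t ω θhat) (-v)
    have h3 : wnorm (B.H lam t ω B.θstar) v ≤ q := Real.sqrt_le_sqrt hH
    have h4 : wnorm (B.H lam t ω θ) (-v) ≤ q := by
      rw [wnorm_eq_sqrt_quad, quad_neg]
      exact Real.sqrt_le_sqrt hH'
    have h5 := mul_le_mul hγ h3 (wnorm_nonneg _ _) hγ0
    have h6 := mul_le_mul hγ' h4 (wnorm_nonneg _ _) hγ0
    linarith
  -- Since q² = (1 + 2S) D, the previous bound is self-improving; q = 0 is treated apart to allow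
  -- the division.
  have hqle : q ≤ 2 * γ * (1 + 2 * B.S) := by
    have hqq : q * q ≤ 2 * γ * (1 + 2 * B.S) * q := by
      rw [hq, Real.mul_self_sqrt (by positivity), ← hq]
      nlinarith
    rcases hq0.eq_or_lt with h0 | h0
    · rw [← h0]; positivity
    · exact le_of_mul_le_mul_right hqq h0
  have hDsq : Real.sqrt D ≤ Real.sqrt (4 + 8 * B.S) * γ := by
    rw [Real.sqrt_le_left (by positivity), mul_pow, Real.sq_sqrt (by positivity)]
    nlinarith
  have hwV : wnorm (B.V lam t ω) v ≤ Real.sqrt B.kappa * (Real.sqrt (4 + 8 * B.S) * γ) := by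
    calc wnorm (B.V lam t ω) v ≤ Real.sqrt (B.kappa * D) := Real.sqrt_le_sqrt hV
      _ = Real.sqrt B.kappa * Real.sqrt D := Real.sqrt_mul (by linarith) _
      _ ≤ _ := by gcongr
  have hwneg : wnorm (B.V lam t ω) (-v) = wnorm (B.V lam t ω) v := by
    rw [wnorm_eq_sqrt_quad, quad_neg, wnorm_eq_sqrt_quad]
  have habs : |inner ℝ a v| ≤ wnorm (B.V lam t ω)⁻¹ a * wnorm (B.V lam t ω) v := by
    have h1 := inner_le_wnorm_inv_mul_wnorm (B.posDef_V hlam t ω) a v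
    have h2 := inner_le_wnorm_inv_mul_wnorm (B.posDef_V hlam t ω) a (-v)
    rw [inner_neg_right, hwneg] at h2
    exact abs_le.2 ⟨by linarith, h1⟩
  calc |inner ℝ a v| ≤ wnorm (B.V lam t ω)⁻¹ a * wnorm (B.V lam t ω) v := habs
    _ ≤ wnorm (B.V lam t ω)⁻¹ a * (Real.sqrt B.kappa * (Real.sqrt (4 + 8 * B.S) * γ)) := by
      have := wnorm_nonneg (B.V lam t ω)⁻¹ a
      gcongr
    _ = _ := by ring

/-! ### Elliptical potential and regret summation. -/

theorem V_succ (lam : ℝ) {t : ℕ} (ht : 1 ≤ t) (ω : Ω) :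
    B.V lam (t + 1) ω = B.V lam t ω + outer (B.x t ω) := by
  rw [V, V, Finset.sum_Ico_succ_top ht]
  abel

theorem sum_log_one_add_quad_inv_V [Nonempty Ω] {lam : ℝ} (hlam : 0 < lam) (T : ℕ) (ω : Ω) :
    ∑ t ∈ Finset.Icc 1 T, Real.log (1 + quad (B.V lam t ω)⁻¹ (B.x t ω)) =
      Real.log (B.V lam (T + 1) ω).det - Real.log (B.V lam 1 ω).det := by
  induction T with
  | zero => simp
  | succ T ih =>
    have hPD := B.posDef_V hlam (T + 1) ω
    have hq := hPD.inv.quad_nonneg (B.x (T + 1) ω)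
    rw [Finset.sum_Icc_succ_top (by omega), ih, B.V_succ lam (t := T + 1) (by omega) ω, det_add_outer hPD,
      Real.log_mul hPD.det_pos.ne' (by positivity)]
    ring

theorem log_det_V_sub_le [Nonempty Ω] (hd : 1 ≤ d) {lam : ℝ} (hlam : 0 < lam) (T : ℕ) (ω : Ω) :
    Real.log (B.V lam (T + 1) ω).det - Real.log (B.V lam 1 ω).det ≤
      d * Real.log (1 + T / (B.kappa * lam * d)) := by
  have hκ := B.four_le_kappa
  have hd0 : (0 : ℝ) < d := by positivity
  have hkl : 0 < B.kappa * lam := by positivity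
  have hPD := B.posDef_V hlam (T + 1) ω
  have hV1 : (B.V lam 1 ω).det = (B.kappa * lam) ^ d := by
    simp [V]
  have htr : (B.V lam (T + 1) ω).trace ≤ T + B.kappa * lam * d := by
    rw [V_eq, trace_sum_smul_outer_add]
    gcongr
    calc ∑ s ∈ Finset.Ico 1 (T + 1), 1 * ‖B.x s ω‖ ^ 2
        ≤ ∑ s ∈ Finset.Ico 1 (T + 1), (1 : ℝ) := by
          refine Finset.sum_le_sum fun s hs => ?_
          have hs1 := (Finset.mem_Ico.1 hs).1
          rw [one_mul]
          exact pow_le_one₀ (norm_nonneg _) (B.norm_le_one s hs1 ω _ (B.x_mem s hs1 ω))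
      _ = T := by simp
  have htr0 : 0 ≤ (B.V lam (T + 1) ω).trace := hPD.posSemidef.trace_nonneg
  have hdet : (B.V lam (T + 1) ω).det ≤
      (B.kappa * lam) ^ d * (1 + T / (B.kappa * lam * d)) ^ d := by
    refine (hPD.det_le_trace_div_pow hd).trans ?_
    rw [← mul_pow]
    gcongr
    rw [div_le_iff₀ hd0]
    refine htr.trans (le_of_eq ?_)
    field_simp
    ring
  have h1 := Real.log_le_log hPD.det_pos hdet
  rw [Real.log_mul (by positivity) (by positivity), Real.log_pow (n := d) (x := 1 + _)] at h1
  rw [hV1]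
  linarith

/-- The elliptical potential lemma. -/
theorem sum_quad_inv_V_le [Nonempty Ω] (hd : 1 ≤ d) {lam : ℝ} (hlam : 0 < lam) (T : ℕ) (ω : Ω) :
    ∑ t ∈ Finset.Icc 1 T, quad (B.V lam t ω)⁻¹ (B.x t ω) ≤
      2 * max 1 (1 / (B.kappa * lam)) * (d * Real.log (1 + T / (B.kappa * lam * d))) := by
  have hκ := B.four_le_kappa
  have hkl : 0 < B.kappa * lam := by positivity
  calc _ ≤ ∑ t ∈ Finset.Icc 1 T, 2 * max 1 (1 / (B.kappa * lam)) *
        Real.log (1 + quad (B.V lam t ω)⁻¹ (B.x t ω)) := by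
        refine Finset.sum_le_sum fun t ht => ?_
        have ht1 := (Finset.mem_Icc.1 ht).1
        have hPD := B.posDef_V hlam t ω
        refine le_two_mul_log_one_add (hPD.inv.quad_nonneg _) (le_max_left _ _) ?_
        refine le_trans (quad_inv_le hPD hkl (B.le_quad_V lam t ω) _) ?_
        refine le_trans ?_ (le_max_right _ _)
        gcongr
        exact pow_le_one₀ (norm_nonneg _) (B.norm_le_one t ht1 ω _ (B.x_mem t ht1 ω))
    _ = 2 * max 1 (1 / (B.kappa * lam)) *
        (Real.log (B.V lam (T + 1) ω).det - Real.log (B.V lam 1 ω).det) := by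
        rw [← Finset.mul_sum, B.sum_log_one_add_quad_inv_V hlam]
    _ ≤ _ := by
        gcongr
        exact B.log_det_V_sub_le hd hlam T ω

/-- Optimism: μ is L-Lipschitz, so the bonus dominates the prediction error at every arm. The played
arm has the largest optimistic index, so only its own bonus survives, counted twice. -/
theorem instantaneous_regret_le [Nonempty Ω] (hd : 1 ≤ d) {lam δ : ℝ} (hlam : 0 < lam)
    (hδ : 0 < δ) (hδ1 : δ ≤ 1) (hB : B.PlayedByGLMUCB lam δ) {t : ℕ} (ht : 1 ≤ t) {ω : Ω}
    (hmix : ENNReal.ofReal δ * mixture (B.H lam t ω B.θstar) (B.score t ω) ≤ ballMass d lam) :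
    Real.sigmoid (inner ℝ B.θstar (B.xstar t ω)) - Real.sigmoid (inner ℝ B.θstar (B.x t ω)) ≤
      2 * B.bonus lam δ t ω (B.x t ω) := by
  obtain ⟨θhat, θ, hmax, hθ, hmin, hplay⟩ := hB t ht ω
  have hγ := B.wnorm_g_sub_le_gam hd hlam hδ hδ1 hmix hmax
  have herr : ∀ a : Vec d, sigmoidL * |inner ℝ a (B.θstar - θ)| ≤ B.bonus lam δ t ω a := fun a => by
    have := B.abs_inner_sub_le hlam hθ hmin hγ a
    calc sigmoidL * |inner ℝ a (B.θstar - θ)| ≤ sigmoidL * (Real.sqrt (4 + 8 * B.S) *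
          Real.sqrt B.kappa * B.gam lam δ t * wnorm (B.V lam t ω)⁻¹ a) := by
          unfold sigmoidL
          gcongr
      _ = _ := by rw [bonus]; ring
  have h1 := sigmoid_sub_le (inner ℝ (B.xstar t ω) θ) (inner ℝ (B.xstar t ω) B.θstar)
  have h2 := sigmoid_sub_le (inner ℝ (B.x t ω) B.θstar) (inner ℝ (B.x t ω) θ)
  rw [← inner_sub_right] at h1
  rw [abs_sub_comm, ← inner_sub_right] at h2
  have h3 := herr (B.xstar t ω)
  have h4 := herr (B.x t ω)
  have h5 : Real.sigmoid (inner ℝ (B.xstar t ω) θ) + B.bonus lam δ t ω (B.xstar t ω) ≤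
      Real.sigmoid (inner ℝ (B.x t ω) θ) + B.bonus lam δ t ω (B.x t ω) :=
    hplay (B.xstar_mem t ht ω)
  unfold sigmoidL at h3 h4
  rw [real_inner_comm, real_inner_comm (B.x t ω)]
  linarith

theorem regret_le [Nonempty Ω] (hd : 1 ≤ d) {lam δ : ℝ} (hlam : 0 < lam)
    (hδ : 0 < δ) (hδ1 : δ ≤ 1) (hB : B.PlayedByGLMUCB lam δ) {ω : Ω}
    (hmix : ∀ t, ENNReal.ofReal δ * mixture (B.H lam t ω B.θstar) (B.score t ω) ≤
      ballMass d lam) (T : ℕ) :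
    B.regret T ω ≤
      B.C₁ lam T * sigmoidL * Real.sqrt B.kappa * B.gam lam δ T * Real.sqrt T := by
  have hS := B.S_nonneg
  have hγ := B.gam_nonneg hlam hδ hδ1 T
  have hL : (0 : ℝ) ≤ sigmoidL := by norm_num [sigmoidL]
  set Λ := 2 * max 1 (1 / (B.kappa * lam)) * (d * Real.log (1 + T / (B.kappa * lam * d))) with hΛ
  have hpot : ∑ t ∈ Finset.Icc 1 T, wnorm (B.V lam t ω)⁻¹ (B.x t ω) ^ 2 ≤ Λ := by
    refine le_trans (le_of_eq (Finset.sum_congr rfl fun t _ => ?_)) (B.sum_quad_inv_V_le hd hlam T ω)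
    exact Real.sq_sqrt ((B.posDef_V hlam t ω).inv.quad_nonneg _)
  have hcs : ∑ t ∈ Finset.Icc 1 T, wnorm (B.V lam t ω)⁻¹ (B.x t ω) ≤
      Real.sqrt T * Real.sqrt Λ := by
    rw [← Real.sqrt_mul (Nat.cast_nonneg T)]
    refine Real.le_sqrt_of_sq_le ?_
    calc _ ≤ ((Finset.Icc 1 T).card : ℝ) *
          ∑ t ∈ Finset.Icc 1 T, wnorm (B.V lam t ω)⁻¹ (B.x t ω) ^ 2 := sq_sum_le_card_mul_sum_sq
      _ ≤ _ := by
        rw [Nat.card_Icc, Nat.add_sub_cancel]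
        gcongr
  -- The 32 in `C₁` is 2² from the doubled bonus, 4 from 4 + 8S = 4(1 + 2S), and 2 from the
  -- potential lemma.
  have hC : B.C₁ lam T = 2 * Real.sqrt (4 + 8 * B.S) * Real.sqrt Λ := by
    have h4 : (2 : ℝ) = Real.sqrt 4 := by
      rw [show (4 : ℝ) = 2 ^ 2 by norm_num, Real.sqrt_sq (by norm_num)]
    rw [C₁, h4, ← Real.sqrt_mul (by norm_num), ← Real.sqrt_mul (by positivity)]
    congr 1
    rw [hΛ]
    ring
  calc B.regret T ω ≤ ∑ t ∈ Finset.Icc 1 T, 2 * B.bonus lam δ t ω (B.x t ω) := by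
        refine Finset.sum_le_sum fun t ht => ?_
        exact B.instantaneous_regret_le hd hlam hδ hδ1 hB (Finset.mem_Icc.1 ht).1 (hmix t)
    _ ≤ ∑ t ∈ Finset.Icc 1 T, 2 * (sigmoidL * Real.sqrt (4 + 8 * B.S) * Real.sqrt B.kappa *
          B.gam lam δ T) * wnorm (B.V lam t ω)⁻¹ (B.x t ω) := by
        refine Finset.sum_le_sum fun t ht => ?_
        have := B.gam_mono hlam hδ hδ1 (Finset.mem_Icc.1 ht).2
        have := wnorm_nonneg (B.V lam t ω)⁻¹ (B.x t ω)
        rw [bonus, ← mul_assoc]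
        gcongr
    _ = 2 * (sigmoidL * Real.sqrt (4 + 8 * B.S) * Real.sqrt B.kappa * B.gam lam δ T) *
          ∑ t ∈ Finset.Icc 1 T, wnorm (B.V lam t ω)⁻¹ (B.x t ω) := by rw [Finset.mul_sum]
    _ ≤ 2 * (sigmoidL * Real.sqrt (4 + 8 * B.S) * Real.sqrt B.kappa * B.gam lam δ T) *
          (Real.sqrt T * Real.sqrt Λ) := by gcongr
    _ = _ := by rw [hC]; ring

theorem holdsWithProb_regret_le [IsProbabilityMeasure P] (hd : 1 ≤ d) {lam δ : ℝ}
    (hlam : 0 < lam) (hδ : 0 < δ) (hδ1 : δ ≤ 1) (hB : B.PlayedByGLMUCB lam δ) :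
    HoldsWithProb P (1 - δ) fun ω => ∀ T : ℕ, B.regret T ω ≤
      B.C₁ lam T * sigmoidL * Real.sqrt B.kappa * B.gam lam δ T * Real.sqrt T := by
  have : Nonempty Ω := P.nonempty_of_neZero
  obtain ⟨A, hA, hPA, h⟩ := B.holdsWithProb_mixture_le hlam hδ
  exact ⟨A, hA, hPA, fun ω hω => B.regret_le hd hlam hδ hδ1 hB (h ω hω)⟩

end LogisticBandit

/-! ### The horizon-tuned choice λ = d log T. -/

namespace LogisticBandit

variable {d : ℕ} {Ω : Type*} [mΩ : MeasurableSpace Ω] {P : Measure Ω} (B : LogisticBandit d P)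

theorem half_le_mul_log (hd : 1 ≤ d) {T : ℕ} (hT : 2 ≤ T) : 1 / 2 ≤ d * Real.log T := by
  have hd1 : (1 : ℝ) ≤ d := by exact_mod_cast hd
  have hT2 : (2 : ℝ) ≤ T := by exact_mod_cast hT
  have h1 := Real.log_le_log (by norm_num) hT2
  have h2 := Real.log_two_gt_d9
  nlinarith

theorem log_one_add_le_two_mul_log {T : ℕ} (hT : 2 ≤ T) {y : ℝ} (hy0 : 0 ≤ y) (hy : y ≤ T) :
    Real.log (1 + y) ≤ 2 * Real.log T := by
  have hT2 : (2 : ℝ) ≤ T := by exact_mod_cast hT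
  rw [← Real.log_rpow (by linarith)]
  apply Real.log_le_log (by linarith)
  rw [Real.rpow_two]
  nlinarith

theorem C₁_horizon_le [Nonempty Ω] (hd : 1 ≤ d) {T : ℕ} (hT : 2 ≤ T) :
    B.C₁ (d * Real.log T) T ≤ 8 * Real.sqrt (1 + 2 * B.S) * Real.sqrt (d * Real.log T) := by
  have hκ := B.four_le_kappa
  have hS := B.S_nonneg
  have hlam := half_le_mul_log hd hT
  have hd1 : (1 : ℝ) ≤ d := by exact_mod_cast hd
  -- From κ ≥ 4 and λ ≥ 1/2; the maximum in `C₁` then equals 1.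
  have hkl : 1 ≤ B.kappa * (d * Real.log T) := by nlinarith
  have hmax : max 1 (1 / (B.kappa * (d * Real.log T))) = 1 := by
    rw [max_eq_left]
    exact (div_le_one (by linarith)).2 hkl
  have hlog : Real.log (1 + T / (B.kappa * (d * Real.log T) * d)) ≤ 2 * Real.log T := by
    refine log_one_add_le_two_mul_log hT (by positivity) ?_
    exact div_le_self (by positivity) (by nlinarith)
  have h8 : (8 : ℝ) = Real.sqrt 64 := by
    rw [show (64 : ℝ) = 8 ^ 2 by norm_num, Real.sqrt_sq (by norm_num)]
  rw [C₁, hmax, h8, ← Real.sqrt_mul (by norm_num), ← Real.sqrt_mul (by positivity)]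
  apply Real.sqrt_le_sqrt
  calc _ ≤ 32 * d * (1 + 2 * B.S) * 1 * (2 * Real.log T) := by gcongr
    _ = _ := by ring

theorem gam_horizon_le (hd : 1 ≤ d) {δ : ℝ} (hδ : 0 < δ) (hδ1 : δ ≤ 1) {T : ℕ} (hT : 2 ≤ T) :
    B.gam (d * Real.log T) δ T ≤
      Real.sqrt (d * Real.log T) * (B.S + 9 / 2 + 4 * Real.log (1 / δ)) := by
  have hlam := half_le_mul_log hd hT
  set lam := d * Real.log T with hlamdef
  have hlam0 : 0 < lam := by linarith
  have hd1 : (1 : ℝ) ≤ d := by exact_mod_cast hd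
  have hT2 : (2 : ℝ) ≤ T := by exact_mod_cast hT
  have hδlog : 0 ≤ Real.log (1 / δ) := Real.log_nonneg ((one_le_div hδ).2 hδ1)
  have hz0 : 0 ≤ sigmoidL * T / (d * lam) := by unfold sigmoidL; positivity
  have hz : sigmoidL * T / (d * lam) ≤ T := by
    rw [div_le_iff₀ (by positivity)]
    unfold sigmoidL
    have : 1 / 4 ≤ d * lam := by nlinarith
    nlinarith
  have hlog2 : Real.log 2 ≤ Real.log T := Real.log_le_log (by norm_num) hT2
  -- The terms d log 2 and (d/2) log(1 + ·) are each at most λ, and 1 ≤ 2λ absorbs log(1/δ).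
  -- Multiplying by 2/√λ gives √λ (4 + 4 log(1/δ)), whence 9/2 = 1/2 + 4.
  have hlog : Real.log ((2 : ℝ) ^ d / δ * (1 + sigmoidL * T / (d * lam)) ^ ((d : ℝ) / 2)) ≤
      lam * (2 + 2 * Real.log (1 / δ)) := by
    have e : (2 : ℝ) ^ d / δ = 2 ^ d * (1 / δ) := by ring
    rw [e, Real.log_mul (by positivity) (by positivity), Real.log_mul (by positivity)
      (by positivity), Real.log_pow, Real.log_rpow (by positivity)]
    have h1 : (d : ℝ) * Real.log 2 ≤ lam := by rw [hlamdef]; gcongr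
    have h2 : (d : ℝ) / 2 * Real.log (1 + sigmoidL * T / (d * lam)) ≤ lam := by
      calc _ ≤ (d : ℝ) / 2 * (2 * Real.log T) := by
            gcongr
            exact log_one_add_le_two_mul_log hT hz0 hz
        _ = lam := by rw [hlamdef]; ring
    nlinarith
  have hsl : 0 < Real.sqrt lam := Real.sqrt_pos.2 hlam0
  rw [gam]
  calc _ ≤ Real.sqrt lam * (B.S + 1 / 2) +
        2 / Real.sqrt lam * (lam * (2 + 2 * Real.log (1 / δ))) := by gcongr
    _ = Real.sqrt lam * (B.S + 1 / 2) +
        lam / Real.sqrt lam * (2 * (2 + 2 * Real.log (1 / δ))) := by ring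
    _ = _ := by rw [Real.div_sqrt]; ring

theorem bound_horizon_le [Nonempty Ω] (hd : 1 ≤ d) {δ : ℝ} (hδ : 0 < δ) (hδ1 : δ ≤ 1) {T : ℕ}
    (hT : 2 ≤ T) :
    B.C₁ (d * Real.log T) T * sigmoidL * Real.sqrt B.kappa * B.gam (d * Real.log T) δ T *
        Real.sqrt T ≤
      2 * Real.sqrt (1 + 2 * B.S) * (B.S + 9 / 2 + 4 * Real.log (1 / δ)) *
        (Real.sqrt B.kappa * d * Real.sqrt T * Real.log T) := by
  have hlam := half_le_mul_log hd hT
  have hγ := B.gam_nonneg (lam := d * Real.log T) (by linarith) hδ hδ1 T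
  calc _ ≤ (8 * Real.sqrt (1 + 2 * B.S) * Real.sqrt (d * Real.log T)) * sigmoidL *
        Real.sqrt B.kappa *
        (Real.sqrt (d * Real.log T) * (B.S + 9 / 2 + 4 * Real.log (1 / δ))) * Real.sqrt T := by
        have hL : (0 : ℝ) ≤ sigmoidL := by norm_num [sigmoidL]
        gcongr
        · exact B.C₁_horizon_le hd hT
        · exact B.gam_horizon_le hd hδ hδ1 hT
    _ = (Real.sqrt (d * Real.log T) * Real.sqrt (d * Real.log T)) * (8 * sigmoidL) *
        Real.sqrt (1 + 2 * B.S) * (B.S + 9 / 2 + 4 * Real.log (1 / δ)) *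
        Real.sqrt B.kappa * Real.sqrt T := by ring
    -- The two factors √λ, from `C₁` and from `gam`, multiply to d log T, and 8L = 2.
    _ = _ := by
        rw [Real.mul_self_sqrt (by linarith), sigmoidL]
        ring

end LogisticBandit

end

theorem theorem2 :
    (∀ (d : ℕ) (Ω : Type*) [MeasurableSpace Ω] (P : Measure Ω) [IsProbabilityMeasure P]
        (B : LogisticBandit d P) (lam δ : ℝ),
      1 ≤ d → 0 < lam → 0 < δ → δ ≤ 1 → B.PlayedByGLMUCB lam δ →
        HoldsWithProb P (1 - δ) (fun ω => ∀ T : ℕ, 1 ≤ T →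
          B.regret T ω ≤
            B.C₁ lam T * sigmoidL * Real.sqrt B.kappa * B.gam lam δ T * Real.sqrt T)) ∧
    (∃ C : ℝ → ℝ → ℝ,
      ∀ (d : ℕ) (Ω : Type*) [MeasurableSpace Ω] (P : Measure Ω) [IsProbabilityMeasure P]
        (B : LogisticBandit d P) (δ : ℝ) (T : ℕ),
      1 ≤ d → 0 < δ → δ ≤ 1 → 2 ≤ T → B.PlayedByGLMUCB (d * Real.log T) δ →
        HoldsWithProb P (1 - δ) (fun ω =>
          B.regret T ω ≤
            C B.S δ * (Real.sqrt B.kappa * d * Real.sqrt T * Real.log T))) := by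
  refine ⟨fun d Ω _ P _ B lam δ hd hlam hδ hδ1 hB => ?_,
    fun S δ => 2 * Real.sqrt (1 + 2 * S) * (S + 9 / 2 + 4 * Real.log (1 / δ)),
    fun d Ω _ P _ B δ T hd hδ hδ1 hT hB => ?_⟩
  · obtain ⟨A, hA, hPA, h⟩ := B.holdsWithProb_regret_le hd hlam hδ hδ1 hB
    exact ⟨A, hA, hPA, fun ω hω T _ => h ω hω T⟩
  · have : Nonempty Ω := P.nonempty_of_neZero
    have hlam := LogisticBandit.half_le_mul_log hd hT
    obtain ⟨A, hA, hPA, h⟩ := B.holdsWithProb_regret_le hd (by linarith) hδ hδ1 hB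
    exact ⟨A, hA, hPA, fun ω hω => (h ω hω T).trans (B.bound_horizon_le hd hδ hδ1 hT)⟩
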